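/- A structured matrix $\bar M\in\{0,*\}^{k\times n}$ has entries that are either fixed zeros or independent free real parameters ($*$); its realizations are the real matrices obtained by giving values to the parameters, $n_{\bar M}$ is the number of its $*$ entries, and its generic rank $\mathrm{grank}\,\bar M$ is the maximum rank of a realization. A proper variety in $\mathbb R^d$ is the set of common real zeros of a system of polynomials, different from $\mathbb R^d$. A structured matrix $\bar A\in\{0,*\}^{n\times n}$ is generically diagonalizable if all its realizations outside some proper variety of $\mathbb R^{n_{\bar A}}$ are diagonalizable over $\mathbb C$. A real triple $(A,C,F)$ is functionally observable if, for the system $\dot x=Ax+Bu$, $y=Cx$ (with any input matrix $B$), for every initial state $x(0)$ and input $u$ there is a finite time $T>0$ such that $Fx(0)$ is uniquely determined by $y(t)$ and $u(t)$, $0\le t\le T$. A structured triple $(\bar A,\bar C,\bar F)$ is structurally functionally observable (SFO) if all its realizations outside some proper variety of $\mathbb R^{n_{\bar A}}\times\mathbb R^{n_{\bar C}}\times\mathbb R^{n_{\bar F}}$ are functionally observable. Let $\mathcal B(\bar A)$ be the bipartite graph whose right vertices $x_1,\dots,x_n$ are the columns of $\bar A$ and whose left vertices $x_1,\dots,x_n$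 are its rows, with an edge $(x_i,x_j)$ from the right vertex $x_i$ to the left vertex $x_j$ whenever $\bar A_{ji}=*$. For $\bar F\in\{0,*\}^{r\times n}$ let $X_F$ be the set of the $x_i$ for which column $i$ of $\bar F$ is nonzero, and let $\bar I_{X_F}$ be the structured matrix with one row for each $x_i\in X_F$, whose only $*$ is in column $i$. **Theorem.** Let $\bar A\in\{0,*\}^{n\times n}$ be generically diagonalizable and $\bar F\in\{0,*\}^{r\times n}$. Let $p^*$ be the least integer $p\ge 1$ for which there is $\bar C\in\{0,*\}^{p\times n}$ such that $(\bar A,\bar C,\bar F)$ is SFO. (If $X_F\ne\emptyset$, the restriction $p\ge1$ is automatic: no matrix with $0$ rows achieves SFO.) Then $p^*$ exists and $$p^*=\max\{\mathrm{grank}\,[\bar A;\bar I_{X_F}]-\mathrm{grank}\,\bar A,\ 1\}.$$ Moreover, if $X_F^u$ is a subset of $X_F$ of maximum cardinality among the subsets of $X_F$ that are right-unmatched by some maximum matching of $\mathcal B(\bar A)$ (such a subset exists), then $p^*=\max\{|X_F^u|,1\}$. Finally, the following algorithm can always be carried out and, whatever choices it makes, returns an optimal solution, i.e. a matrix $\bar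 C$ with exactly $p^*$ rows such that $(\bar A,\bar C,\bar F)$ is SFO. (1) Give the edge $(x_i,x_j)$ of $\mathcal B(\bar A)$ cost $1$ if $x_i\in X_F$ and cost $0$ otherwise. (2) Choose a maximum matching $\mathcal M$ of $\mathcal B(\bar A)$ of minimum total cost among all maximum matchings; let $X_{\mathcal M}$ be the set of its right-matched vertices, $X_S=X_F\cap X_{\mathcal M}$ and $X_F^u=X_F\setminus X_S$. (3) Start from the $\max\{1,|X_F^u|\}\times n$ zero matrix $\bar C$, enumerate $X_F^u$, and put $\bar C_{ki}=*$ whenever $x_i$ is the $k$th element of $X_F^u$. (4) For each $x_i\in X_S$ choose one row $j$ and put $\bar C_{ji}=*$. (5) Return $\bar C$. -/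

import Mathlib

namespace StructuredSystem

/-- A structured matrix, an element of `{0,*}^{m × n}`: the entry `true` stands for `*` (a free
parameter) and `false` for a fixed zero. -/
abbrev StructuredMatrix (m n : Type*) := Matrix m n Bool

/-- The positions of the `*` entries of a structured matrix. -/
abbrev Stars {m n : Type*} (M : StructuredMatrix m n) := {e : m × n // M e.1 e.2 = true}

/-- The realization of `M` at the parameter vector `θ`: the `*` entries get the values given
by `θ`, all the others are zero. -/
def realize {m n : Type*} (M : StructuredMatrix m n) (θ : Stars M → ℝ) : Matrix m n ℝ :=
  Matrix.of fun i j => if h : M i j = true then θ ⟨(i, j), h⟩ else 0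

/-- The generic rank: the maximum rank over all realizations. (The supremum is that of a nonempty
set of naturals bounded by the number of columns, so it is a maximum.) -/
noncomputable def grank {m n : Type*} [Fintype n] (M : StructuredMatrix m n) : ℕ :=
  ⨆ θ : Stars M → ℝ, (realize M θ).rank

/-- A proper variety in `ℝ^σ`: the set of common zeros of a system of real polynomials that is
not the whole space. -/
def IsProperVariety {σ : Type*} (V : Set (σ → ℝ)) : Prop :=
  (∃ S : Set (MvPolynomial σ ℝ), V = {x | ∀ p ∈ S, MvPolynomial.eval x p = 0}) ∧ V ≠ Set.univ

/-- A real square matrix is diagonalizable (over `ℂ`). -/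
def IsDiagonalizable {n : Type*} [Fintype n] [DecidableEq n] (A : Matrix n n ℝ) : Prop :=
  ∃ (P : Matrix n n ℂ) (d : n → ℂ), IsUnit P.det ∧
    A.map Complex.ofReal = P * Matrix.diagonal d * P⁻¹

/-- `A` is generically diagonalizable: all realizations outside some proper variety are
diagonalizable. -/
def GenericallyDiagonalizable {n : Type*} [Fintype n] [DecidableEq n]
    (A : StructuredMatrix n n) : Prop :=
  ∃ V : Set (Stars A → ℝ), IsProperVariety V ∧ ∀ θ ∉ V, IsDiagonalizable (realize A θ)

/-- `x` is a state trajectory on `[0, ∞)` of `ẋ(t) = A x(t) + B u(t)`. -/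
def IsTrajectory {n m : Type*} [Fintype n] [Fintype m] (A : Matrix n n ℝ) (B : Matrix n m ℝ)
    (u : ℝ → m → ℝ) (x : ℝ → n → ℝ) : Prop :=
  ∀ t : ℝ, 0 ≤ t →
    HasDerivWithinAt x (A.mulVec (x t) + B.mulVec (u t)) (Set.Ici 0) t

/-- Functional observability of `(A, C, F)`, i.e. of `ẋ = A x + B u`, `y = C x`, `z = F x`
(whatever the input matrix `B`): for any initial state `x(0)` and input `u` there is a finite time
`T` such that `F x(0)` is uniquely determined by the output and the input on `[0, T]`, that is,
any other trajectory with the same input and the same output on `[0, T]` has the same `F x(0)`. -/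
def FunctionallyObservable {n p r : Type*} [Fintype n]
    (A : Matrix n n ℝ) (C : Matrix p n ℝ) (F : Matrix r n ℝ) : Prop :=
  ∀ (m : ℕ) (B : Matrix n (Fin m) ℝ) (u : ℝ → Fin m → ℝ) (x₀ : n → ℝ),
    ∃ T : ℝ, 0 < T ∧ ∀ x x' : ℝ → n → ℝ,
      IsTrajectory A B u x → x 0 = x₀ → IsTrajectory A B u x' →
      (∀ t ∈ Set.Icc 0 T, C.mulVec (x t) = C.mulVec (x' t)) →
      F.mulVec (x 0) = F.mulVec (x' 0)

/-- Structural functional observability of `(A, C, F)`: all realizations outside some proper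
variety of the joint parameter space are functionally observable. -/
def SFO {n p r : Type*} [Fintype n] (A : StructuredMatrix n n) (C : StructuredMatrix p n)
    (F : StructuredMatrix r n) : Prop :=
  ∃ V : Set (Stars A ⊕ Stars C ⊕ Stars F → ℝ), IsProperVariety V ∧
    ∀ θ ∉ V, FunctionallyObservable
      (realize A fun s => θ (Sum.inl s))
      (realize C fun s => θ (Sum.inr (Sum.inl s)))
      (realize F fun s => θ (Sum.inr (Sum.inr s)))

/-- The functional states `X_F`: the indices of the nonzero columns of `F`. -/
def functionalStates {r n : ℕ} (F : StructuredMatrix (Fin r) (Fin n)) : Finset (Fin n) :=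
  Finset.univ.filter fun i => ∃ k, F k i = true

/-- The structured matrix `I_X` with one row for each `i ∈ X`, whose only `*` is in column `i`. -/
def structuredId {n : ℕ} (X : Finset (Fin n)) : StructuredMatrix {i // i ∈ X} (Fin n) :=
  Matrix.of fun i j => decide (i.1 = j)

/-- `p` is an admissible number of sensors: some `p × n` structured output matrix achieves SFO. -/
def SensorsSuffice {n r : ℕ} (A : StructuredMatrix (Fin n) (Fin n))
    (F : StructuredMatrix (Fin r) (Fin n)) (p : ℕ) : Prop :=
  ∃ C : StructuredMatrix (Fin p) (Fin n), SFO A C F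

/-- The edges `(x_i, x_j)`, with `A j i = *`, of the bipartite graph of `A`. The first component
is the right vertex (a column of `A`), the second one the left vertex (a row of `A`). -/
def edges {n : ℕ} (A : StructuredMatrix (Fin n) (Fin n)) : Finset (Fin n × Fin n) :=
  Finset.univ.filter fun e => A e.2 e.1 = true

/-- A matching: a set of edges no two of which share a left or a right end vertex. -/
def IsMatching {n : ℕ} (A : StructuredMatrix (Fin n) (Fin n))
    (M : Finset (Fin n × Fin n)) : Prop :=
  M ⊆ edges A ∧ ∀ e ∈ M, ∀ f ∈ M, e ≠ f → e.1 ≠ f.1 ∧ e.2 ≠ f.2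

/-- A matching of the largest size. -/
def IsMaximumMatching {n : ℕ} (A : StructuredMatrix (Fin n) (Fin n))
    (M : Finset (Fin n × Fin n)) : Prop :=
  IsMatching A M ∧ ∀ M', IsMatching A M' → M'.card ≤ M.card

/-- The right-matched vertices of `M`. -/
def rightMatched {n : ℕ} (M : Finset (Fin n × Fin n)) : Finset (Fin n) :=
  M.image Prod.fst

/-- `S` is a subset of `X` that is right-unmatched by some maximum matching. -/
def IsRightUnmatchedSubset {n : ℕ} (A : StructuredMatrix (Fin n) (Fin n))
    (X S : Finset (Fin n)) : Prop :=
  S ⊆ X ∧ ∃ M, IsMaximumMatching A M ∧ Disjoint S (rightMatched M)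

/-- `S` has maximum cardinality among the subsets of `X` that are right-unmatched by some maximum
matching. -/
def IsLargestRightUnmatchedSubset {n : ℕ} (A : StructuredMatrix (Fin n) (Fin n))
    (X S : Finset (Fin n)) : Prop :=
  IsRightUnmatchedSubset A X S ∧ ∀ S', IsRightUnmatchedSubset A X S' → S'.card ≤ S.card

/-- The weight of `M` when the edge `(x_i, x_j)` costs `1` if `i ∈ X` and `0` otherwise. -/
def weight {n : ℕ} (X : Finset (Fin n)) (M : Finset (Fin n × Fin n)) : ℕ :=
  ∑ e ∈ M, if e.1 ∈ X then 1 else 0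

/-- A maximum matching of the least weight among all maximum matchings. -/
def IsMinWeightMaximumMatching {n : ℕ} (A : StructuredMatrix (Fin n) (Fin n))
    (X : Finset (Fin n)) (M : Finset (Fin n × Fin n)) : Prop :=
  IsMaximumMatching A M ∧ ∀ M', IsMaximumMatching A M' → weight X M ≤ weight X M'

/-- `X_S = X_F ∩ X_M`, the functional states that are right-matched by `M`. -/
def matchedFunctional {n r : ℕ} (F : StructuredMatrix (Fin r) (Fin n))
    (M : Finset (Fin n × Fin n)) : Finset (Fin n) :=
  functionalStates F ∩ rightMatched M

/-- `X_F^u = X_F \ X_S`, the functional states that are not right-matched by `M`. -/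
def unmatchedFunctional {n r : ℕ} (F : StructuredMatrix (Fin r) (Fin n))
    (M : Finset (Fin n × Fin n)) : Finset (Fin n) :=
  functionalStates F \ matchedFunctional F M

/-- A run of the sensor placement algorithm on `(A, F)`: the choices that it makes, namely a minimum
weight maximum matching `M`, an enumeration of `X_F^u`, and a row for each element of `X_S`. -/
structure SensorAlgorithmRun {n r : ℕ} (A : StructuredMatrix (Fin n) (Fin n))
    (F : StructuredMatrix (Fin r) (Fin n)) where
  M : Finset (Fin n × Fin n)
  isMinWeight : IsMinWeightMaximumMatching A (functionalStates F) M
  enum : Fin (unmatchedFunctional F M).card ≃ {i // i ∈ unmatchedFunctional F M}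
  row : {i // i ∈ matchedFunctional F M} → Fin (max 1 (unmatchedFunctional F M).card)

/-- The output of a run: the structured matrix with `max {1, |X_F^u|}` rows whose `*` entries are
those at `(k, i)` where `x_i` is the `k`-th element of `X_F^u`, or `x_i ∈ X_S` and `k` is the row
chosen for `x_i`. -/
def SensorAlgorithmRun.output {n r : ℕ} {A : StructuredMatrix (Fin n) (Fin n)}
    {F : StructuredMatrix (Fin r) (Fin n)} (R : SensorAlgorithmRun A F) :
    StructuredMatrix (Fin (max 1 (unmatchedFunctional F R.M).card)) (Fin n) :=
  Matrix.of fun k i => decide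
    ((∃ t : Fin (unmatchedFunctional F R.M).card, (t : ℕ) = (k : ℕ) ∧ (R.enum t : Fin n) = i) ∨
      ∃ s : {i // i ∈ matchedFunctional F R.M}, s.1 = i ∧ R.row s = k)

/-- `C` is an optimal solution of the minimal sensor placement problem for `(A, F)`: it achieves
SFO, and no structured output matrix with at least one row that does so has fewer rows. -/
def IsOptimalPlacement {n r p : ℕ} (A : StructuredMatrix (Fin n) (Fin n))
    (F : StructuredMatrix (Fin r) (Fin n)) (C : StructuredMatrix (Fin p) (Fin n)) : Prop :=
  SFO A C F ∧ IsLeast {q | 1 ≤ q ∧ SensorsSuffice A F q} p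

end StructuredSystem

open StructuredSystem

/-! Functional observability means that the unobservable subspace, the intersection of the kernels
of all `C * A ^ k`, lies in `ker F`. For generic parameters of `F` this says that the coordinates in
`X_F` vanish on that subspace.

Lower bound (`SFO.extendedRank_le`): a vector of `ker A ∩ ker C` is unobservable, so its `X_F`
coordinates vanish. Hence `rank [A; I_X] ≤ rank [A; C] ≤ rank A + p`.

Upper bound (`sfo_of_extendedRank_le`): the generic characteristic polynomial is affine in each
parameter, so a factor occurring twice contains no parameter; setting all parameters to zero shows
that it is a power of the variable. Thus the nonzero eigenvalues are generically simple. With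
diagonalizability, an unobservable vector splits into eigencomponents. One for a nonzero eigenvalue
is zero if `C` sees its eigenvector, and a star of a generic `C` in column `x` sees every
eigenvector with nonzero `x` coordinate. What remains lies in `ker A ∩ ker C`, and has zero `X_F`
coordinates once `[A; C]` reaches the rank of `[A; I_X]`.

Combinatorics (`exists_isMatching_card_eq`, `IsMatching.card_add_card_le_rank`): the rank gap is the
largest number of elements of `X_F` left unmatched by a maximum matching. A matching together with
unit rows at unmatched vertices gives an identity submatrix. Conversely, a column basis using as few
columns of `X_F` as possible is right-matched by some matching, by Hall's theorem. -/

namespace StructuredSystem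

/-! ### Generic properties, polynomial functions and generic rank. -/

open Filter Matrix

/-- The filter of the sets of parameter vectors that contain the complement of the zero set of
some nonzero polynomial. -/
def generic (σ : Type*) : Filter (σ → ℝ) where
  sets := {s | ∃ q : MvPolynomial σ ℝ, q ≠ 0 ∧ ∀ θ, MvPolynomial.eval θ q ≠ 0 → θ ∈ s}
  univ_sets := ⟨1, one_ne_zero, fun _ _ => trivial⟩
  sets_of_superset := fun ⟨q, hq, h⟩ hst => ⟨q, hq, fun θ hθ => hst (h θ hθ)⟩
  inter_sets := fun ⟨q, hq, h⟩ ⟨q', hq', h'⟩ => ⟨q * q', mul_ne_zero hq hq', fun θ hθ => by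
    rw [map_mul] at hθ
    exact ⟨h θ (left_ne_zero_of_mul hθ), h' θ (right_ne_zero_of_mul hθ)⟩⟩

theorem eventually_generic_iff {σ : Type*} {P : (σ → ℝ) → Prop} :
    (∀ᶠ θ in generic σ, P θ) ↔
      ∃ q : MvPolynomial σ ℝ, q ≠ 0 ∧ ∀ θ, MvPolynomial.eval θ q ≠ 0 → P θ :=
  Iff.rfl

theorem exists_eval_ne_zero {σ : Type*} {q : MvPolynomial σ ℝ} (hq : q ≠ 0) :
    ∃ θ, MvPolynomial.eval θ q ≠ 0 := by
  by_contra! h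
  exact hq (MvPolynomial.funext fun θ => by simpa using h θ)

instance generic_neBot (σ : Type*) : (generic σ).NeBot := by
  refine ⟨fun h => ?_⟩
  have h' : ∀ᶠ θ in generic σ, False := by simp [h]
  obtain ⟨q, hq, hF⟩ := eventually_generic_iff.1 h'
  obtain ⟨θ, hθ⟩ := exists_eval_ne_zero hq
  exact hF θ hθ

/-- A property holds outside a proper variety if and only if it holds generically. -/
theorem exists_isProperVariety_iff {σ : Type*} {P : (σ → ℝ) → Prop} :
    (∃ V, IsProperVariety V ∧ ∀ θ ∉ V, P θ) ↔ ∀ᶠ θ in generic σ, P θ := by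
  constructor
  · rintro ⟨V, ⟨⟨S, rfl⟩, hV⟩, h⟩
    obtain ⟨θ, hθ⟩ := (Set.ne_univ_iff_exists_notMem _).1 hV
    simp only [Set.mem_ofPred_eq, not_forall] at hθ
    obtain ⟨q, hqS, hq⟩ := hθ
    refine eventually_generic_iff.2 ⟨q, ?_, fun θ' hθ' => h θ' fun hmem => hθ' (hmem q hqS)⟩
    rintro rfl
    simp at hq
  · intro h
    obtain ⟨q, hq, h⟩ := eventually_generic_iff.1 h
    refine ⟨{θ | ∀ p ∈ ({q} : Set (MvPolynomial σ ℝ)), MvPolynomial.eval θ p = 0},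
      ⟨⟨_, rfl⟩, ?_⟩, fun θ hθ => h θ (by simpa using hθ)⟩
    obtain ⟨θ, hθ⟩ := exists_eval_ne_zero hq
    exact (Set.ne_univ_iff_exists_notMem _).2 ⟨θ, by simpa using hθ⟩

/-- The algebra of real polynomial functions on `ℝ^σ`. -/
noncomputable def polyFun (σ : Type*) : Subalgebra ℝ ((σ → ℝ) → ℝ) :=
  (AlgHom.pi fun θ : σ → ℝ => MvPolynomial.aeval θ : MvPolynomial σ ℝ →ₐ[ℝ] _).range

theorem mem_polyFun {σ : Type*} {g : (σ → ℝ) → ℝ} :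
    g ∈ polyFun σ ↔ ∃ q : MvPolynomial σ ℝ, ∀ θ, g θ = MvPolynomial.eval θ q := by
  constructor
  · rintro ⟨q, rfl⟩
    exact ⟨q, fun θ => by simp [MvPolynomial.aeval_eq_eval]⟩
  · rintro ⟨q, hq⟩
    exact ⟨q, funext fun θ => by simp [hq, MvPolynomial.aeval_eq_eval]⟩

theorem coord_mem_polyFun {σ : Type*} (s : σ) : (fun θ : σ → ℝ => θ s) ∈ polyFun σ :=
  mem_polyFun.2 ⟨MvPolynomial.X s, by simp⟩

theorem const_mem_polyFun {σ : Type*} (c : ℝ) : (fun _ : σ → ℝ => c) ∈ polyFun σ :=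
  mem_polyFun.2 ⟨MvPolynomial.C c, by simp⟩

theorem mul_mem_polyFun {σ : Type*} {f g : (σ → ℝ) → ℝ} (hf : f ∈ polyFun σ)
    (hg : g ∈ polyFun σ) : (fun θ => f θ * g θ) ∈ polyFun σ :=
  mul_mem hf hg

theorem sum_mem_polyFun {σ ι : Type*} {s : Finset ι} {f : ι → (σ → ℝ) → ℝ}
    (hf : ∀ i ∈ s, f i ∈ polyFun σ) : (fun θ => ∑ i ∈ s, f i θ) ∈ polyFun σ := by
  have := sum_mem hf
  rwa [show ∑ i ∈ s, f i = fun θ => ∑ i ∈ s, f i θ from funext fun θ => by simp] at this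

theorem prod_mem_polyFun {σ ι : Type*} {s : Finset ι} {f : ι → (σ → ℝ) → ℝ}
    (hf : ∀ i ∈ s, f i ∈ polyFun σ) : (fun θ => ∏ i ∈ s, f i θ) ∈ polyFun σ := by
  have := prod_mem hf
  rwa [show ∏ i ∈ s, f i = fun θ => ∏ i ∈ s, f i θ from funext fun θ => by simp] at this

theorem comp_mem_polyFun {σ τ : Type*} {f : (σ → ℝ) → τ → ℝ}
    (hf : ∀ t, (fun a => f a t) ∈ polyFun σ) {g : (τ → ℝ) → ℝ} (hg : g ∈ polyFun τ) :
    (fun a => g (f a)) ∈ polyFun σ := by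
  choose p hp using fun t => mem_polyFun.1 (hf t)
  obtain ⟨q, hq⟩ := mem_polyFun.1 hg
  refine mem_polyFun.2 ⟨MvPolynomial.bind₁ p q, fun a => ?_⟩
  rw [hq, ← MvPolynomial.aeval_eq_eval, ← MvPolynomial.aeval_eq_eval, MvPolynomial.aeval_bind₁]
  simp only [MvPolynomial.aeval_eq_eval, ← hp]

theorem eventually_ne_zero {σ : Type*} {g : (σ → ℝ) → ℝ} (hg : g ∈ polyFun σ) {θ₀ : σ → ℝ}
    (h : g θ₀ ≠ 0) : ∀ᶠ θ in generic σ, g θ ≠ 0 := by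
  obtain ⟨q, hq⟩ := mem_polyFun.1 hg
  refine eventually_generic_iff.2 ⟨q, ?_, fun θ hθ => by rwa [hq]⟩
  rintro rfl
  simp [hq] at h

/-- A polynomial function that is nonzero at one point is nonzero generically, and two generic
conditions always have a common point. -/
theorem eq_zero_of_eventually {σ : Type*} {g : (σ → ℝ) → ℝ} (hg : g ∈ polyFun σ)
    (h : ∀ᶠ θ in generic σ, g θ = 0) (θ₀ : σ → ℝ) : g θ₀ = 0 := by
  by_contra h₀
  obtain ⟨θ, h1, h2⟩ := (h.and (eventually_ne_zero hg h₀)).exists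
  exact h2 h1

/-- A generic property of a sub-family of the parameters is a generic property of all of them. -/
theorem eventually_comp {σ τ : Type*} {f : σ → τ} (hf : Function.Injective f)
    {P : (σ → ℝ) → Prop} (h : ∀ᶠ a in generic σ, P a) : ∀ᶠ θ in generic τ, P (θ ∘ f) := by
  obtain ⟨q, hq, h⟩ := eventually_generic_iff.1 h
  refine eventually_generic_iff.2 ⟨MvPolynomial.rename f q, ?_, fun θ hθ => h _ ?_⟩
  · rwa [Ne, map_eq_zero_iff _ (MvPolynomial.rename_injective f hf)]
  · rwa [MvPolynomial.eval_rename] at hθ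

/-- Half of a Fubini principle: slicing the polynomial at a point where it is nonzero gives a
nonzero polynomial in each block in turn. The converse fails: `c ≠ exp a` is generic in `c` for each
`a`, but not jointly. -/
theorem eventually_sum {σ τ : Type*} {P : (σ ⊕ τ → ℝ) → Prop}
    (h : ∀ᶠ θ in generic (σ ⊕ τ), P θ) :
    ∀ᶠ a in generic σ, ∀ᶠ c in generic τ, P (Sum.elim a c) := by
  obtain ⟨q, hq, h⟩ := eventually_generic_iff.1 h
  obtain ⟨θ, hθ⟩ := exists_eval_ne_zero hq
  have hev : (fun θ => MvPolynomial.eval θ q) ∈ polyFun (σ ⊕ τ) := mem_polyFun.2 ⟨q, fun _ => rfl⟩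
  have h1 : ∀ c : τ → ℝ, (fun a => MvPolynomial.eval (Sum.elim a c) q) ∈ polyFun σ := fun c =>
    comp_mem_polyFun (f := fun a => Sum.elim a c)
      (Sum.rec coord_mem_polyFun fun t => const_mem_polyFun (c t)) hev
  have h2 : ∀ a : σ → ℝ, (fun c => MvPolynomial.eval (Sum.elim a c) q) ∈ polyFun τ := fun a =>
    comp_mem_polyFun (f := fun c => Sum.elim a c)
      (Sum.rec (fun s => const_mem_polyFun (a s)) coord_mem_polyFun) hev
  have hθ' : MvPolynomial.eval (Sum.elim (θ ∘ Sum.inl) (θ ∘ Sum.inr)) q ≠ 0 := by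
    rwa [Sum.elim_comp_inl_inr]
  filter_upwards [eventually_ne_zero (h1 _) hθ'] with a ha
  filter_upwards [eventually_ne_zero (h2 a) ha] with c hc
  exact h _ hc

theorem det_mem_polyFun {σ m : Type*} [Fintype m] [DecidableEq m]
    {M : (σ → ℝ) → Matrix m m ℝ} (hM : ∀ i j, (fun θ => M θ i j) ∈ polyFun σ) :
    (fun θ => (M θ).det) ∈ polyFun σ := by
  simp only [Matrix.det_apply']
  exact sum_mem_polyFun fun π _ => mul_mem_polyFun (const_mem_polyFun _)
    (prod_mem_polyFun fun i _ => hM _ _)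

theorem mul_apply_mem_polyFun {σ l m n : Type*} [Fintype m] {M : (σ → ℝ) → Matrix l m ℝ}
    {N : (σ → ℝ) → Matrix m n ℝ} (hM : ∀ i j, (fun θ => M θ i j) ∈ polyFun σ)
    (hN : ∀ i j, (fun θ => N θ i j) ∈ polyFun σ) (i : l) (j : n) :
    (fun θ => (M θ * N θ) i j) ∈ polyFun σ := by
  simp only [Matrix.mul_apply]
  exact sum_mem_polyFun fun k _ => mul_mem_polyFun (hM _ _) (hN _ _)

theorem pow_apply_mem_polyFun {σ m : Type*} [Fintype m] [DecidableEq m]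
    {M : (σ → ℝ) → Matrix m m ℝ} (hM : ∀ i j, (fun θ => M θ i j) ∈ polyFun σ) (k : ℕ) (i j : m) :
    (fun θ => (M θ ^ k) i j) ∈ polyFun σ := by
  induction k generalizing i j with
  | zero => simpa using const_mem_polyFun _
  | succ k ih => simpa only [pow_succ] using mul_apply_mem_polyFun ih hM i j

theorem realize_mem_polyFun {m n : Type*} (M : StructuredMatrix m n) (i : m) (j : n) :
    (fun θ => realize M θ i j) ∈ polyFun (Stars M) := by
  by_cases h : M i j = true
  · simpa [realize, h] using coord_mem_polyFun _
  · simpa [realize, h] using const_mem_polyFun 0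

/-- The rank of a polynomial matrix is lower semicontinuous for the generic filter. -/
theorem eventually_rank_le {σ m n : Type*} [Fintype m] [Fintype n] {M : (σ → ℝ) → Matrix m n ℝ}
    (hM : ∀ i j, (fun θ => M θ i j) ∈ polyFun σ) (θ₀ : σ → ℝ) :
    ∀ᶠ θ in generic σ, (M θ₀).rank ≤ (M θ).rank := by
  classical
  obtain ⟨f, hf, -, hli⟩ := Submodule.exists_fun_fin_finrank_span_eq ℝ (Set.range (M θ₀).col)
  choose c hc using hf
  set N : (σ → ℝ) → Matrix m _ ℝ := fun θ => (M θ).submatrix id c with hN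
  have hN0 : LinearIndependent ℝ (N θ₀).col := by
    have : (N θ₀).col = f := funext fun i => by rw [← hc i]; rfl
    rwa [this]
  -- The Gram matrix of independent real columns is invertible. With its left factor frozen at `θ₀`,
  -- its determinant is a polynomial certificate that the rank does not drop.
  have hdet : ((N θ₀)ᵀ * N θ₀).det ≠ 0 := by
    have : Function.Injective ((N θ₀)ᵀ * N θ₀).mulVec := by
      rw [← Matrix.coe_mulVecLin, ← LinearMap.ker_eq_bot, Matrix.ker_mulVecLin_transpose_mul_self,
        LinearMap.ker_eq_bot, Matrix.coe_mulVecLin]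
      exact Matrix.mulVec_injective_iff.2 hN0
    rw [Matrix.mulVec_injective_iff_isUnit] at this
    exact ((Matrix.isUnit_iff_isUnit_det _).1 this).ne_zero
  filter_upwards [eventually_ne_zero (det_mem_polyFun
    (mul_apply_mem_polyFun (M := fun _ => (N θ₀)ᵀ) (N := N) (fun _ _ => const_mem_polyFun _)
      fun _ _ => hM _ _)) hdet] with θ hθ
  calc (M θ₀).rank = ((N θ₀)ᵀ * N θ).rank := by
        rw [Matrix.rank_of_det_ne_zero hθ, Fintype.card_fin, Matrix.rank_eq_finrank_span_cols]
    _ ≤ (N θ).rank := Matrix.rank_mul_le_right _ _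
    _ ≤ (M θ).rank := Matrix.rank_submatrix_le _ _ _

theorem sfo_iff {n p r : Type*} [Fintype n] {A : StructuredMatrix n n} {C : StructuredMatrix p n}
    {F : StructuredMatrix r n} :
    SFO A C F ↔ ∀ᶠ θ in generic (Stars A ⊕ Stars C ⊕ Stars F), FunctionallyObservable
      (realize A fun s => θ (Sum.inl s))
      (realize C fun s => θ (Sum.inr (Sum.inl s)))
      (realize F fun s => θ (Sum.inr (Sum.inr s))) :=
  exists_isProperVariety_iff

theorem GenericallyDiagonalizable.eventually {n : Type*} [Fintype n] [DecidableEq n]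
    {A : StructuredMatrix n n} (h : GenericallyDiagonalizable A) :
    ∀ᶠ a in generic (Stars A), IsDiagonalizable (realize A a) :=
  exists_isProperVariety_iff.1 h

theorem bddAbove_rank_realize {m n : Type*} [Fintype n] (M : StructuredMatrix m n) :
    BddAbove (Set.range fun θ => (realize M θ).rank) :=
  ⟨Fintype.card n, by rintro _ ⟨θ, rfl⟩; exact Matrix.rank_le_card_width _⟩

theorem rank_realize_le_grank {m n : Type*} [Fintype n] (M : StructuredMatrix m n)
    (θ : Stars M → ℝ) : (realize M θ).rank ≤ grank M :=
  le_ciSup (bddAbove_rank_realize M) θ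

theorem exists_rank_realize_eq_grank {m n : Type*} [Fintype n] (M : StructuredMatrix m n) :
    ∃ θ, (realize M θ).rank = grank M :=
  Nat.sSup_mem (Set.range_nonempty _) (bddAbove_rank_realize M)

theorem eventually_rank_eq_grank {m n : Type*} [Fintype m] [Fintype n]
    (M : StructuredMatrix m n) :
    ∀ᶠ θ in generic (Stars M), (realize M θ).rank = grank M := by
  obtain ⟨θ₀, h₀⟩ := exists_rank_realize_eq_grank M
  filter_upwards [eventually_rank_le (realize_mem_polyFun M) θ₀] with θ hθ
  exact le_antisymm (rank_realize_le_grank M θ) (h₀ ▸ hθ)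

end StructuredSystem

/-! ### Functional observability through the unobservable subspace. -/

namespace StructuredSystem

/-- The unobservable subspace of `(A, C)`. -/
def unobservable {n p : Type*} [Fintype n] [DecidableEq n] (A : Matrix n n ℝ) (C : Matrix p n ℝ) :
    Submodule ℝ (n → ℝ) :=
  ⨅ k : ℕ, (C * A ^ k).mulVecLin.ker

theorem mem_unobservable {n p : Type*} [Fintype n] [DecidableEq n] {A : Matrix n n ℝ}
    {C : Matrix p n ℝ} {v : n → ℝ} :
    v ∈ unobservable A C ↔ ∀ k : ℕ, (C * A ^ k).mulVec v = 0 := by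
  simp [unobservable]

theorem mulVec_mem_unobservable {n p : Type*} [Fintype n] [DecidableEq n] {A : Matrix n n ℝ}
    {C : Matrix p n ℝ} {v : n → ℝ} (hv : v ∈ unobservable A C) :
    A.mulVec v ∈ unobservable A C := by
  rw [mem_unobservable] at hv ⊢
  intro k
  rw [Matrix.mulVec_mulVec, Matrix.mul_assoc, ← pow_succ]
  exact hv (k + 1)

/-- The general space `E` allows the flow to be built on the invariant subspace itself, so that its
trajectories stay there by construction. -/
theorem exists_linear_flow {E : Type*} [NormedAddCommGroup E] [NormedSpace ℝ E] [CompleteSpace E]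
    (f : E →L[ℝ] E) (v : E) : ∃ y : ℝ → E, y 0 = v ∧ ∀ t, HasDerivAt y (f (y t)) t := by
  refine ⟨fun t => NormedSpace.exp (t • f) v, by simp, fun t => ?_⟩
  simpa using (hasDerivAt_exp_smul_const' f t).clm_apply (hasDerivAt_const t v)

/-- From every point of the unobservable subspace starts a trajectory of the autonomous system that
stays in it. -/
theorem exists_trajectory_unobservable {n p : Type*} [Fintype n] [DecidableEq n]
    {A : Matrix n n ℝ} {C : Matrix p n ℝ} {v : n → ℝ} (hv : v ∈ unobservable A C) :
    ∃ x : ℝ → n → ℝ, x 0 = v ∧ (∀ t, x t ∈ unobservable A C) ∧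
      ∀ t, HasDerivAt x (A.mulVec (x t)) t := by
  set N := unobservable A C
  obtain ⟨y, hy0, hy⟩ := exists_linear_flow (LinearMap.toContinuousLinearMap
    (A.mulVecLin.restrict fun w hw => mulVec_mem_unobservable hw : N →ₗ[ℝ] N)) ⟨v, hv⟩
  exact ⟨fun t => y t, congrArg Subtype.val hy0, fun t => (y t).2,
    fun t => N.subtypeL.hasFDerivAt.comp_hasDerivAt t (hy t)⟩

/-- Functional observability means that the unobservable subspace lies in the kernel of `F`. -/
theorem functionallyObservable_iff {n p r : Type*} [Fintype n] [DecidableEq n]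
    {A : Matrix n n ℝ} {C : Matrix p n ℝ} {F : Matrix r n ℝ} :
    FunctionallyObservable A C F ↔ ∀ v ∈ unobservable A C, F.mulVec v = 0 := by
  constructor
  · intro h v hv
    -- No input channel and zero initial state: the trajectory from `v` is compared with the zero
    -- trajectory.
    obtain ⟨T, -, hT⟩ := h 0 0 0 0
    obtain ⟨x, hx0, hxN, hx⟩ := exists_trajectory_unobservable hv
    have := hT 0 x (fun t _ => (hasDerivWithinAt_const t _ (0 : n → ℝ)).congr_deriv (by simp)) rfl
      (fun t _ => (hx t).hasDerivWithinAt.congr_deriv (by simp))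
      (fun t _ => by simpa using (mem_unobservable.1 (hxN t) 0).symm)
    rw [hx0] at this
    simpa using this.symm
  · intro h m B u x₀
    refine ⟨1, one_pos, fun x x' hx _ hx' hy => ?_⟩
    have he (t : ℝ) (ht : 0 ≤ t) :
        HasDerivWithinAt (fun t => x t - x' t) (A.mulVec (x t - x' t)) (Set.Ici 0) t := by
      refine ((hx t ht).sub (hx' t ht)).congr_deriv ?_
      rw [Matrix.mulVec_sub]
      abel
    -- Differentiating `C A^k e = 0` along `e' = A e` gives the next power. Derivatives within `[0,
    -- 1]` are unique even at the endpoint `0`, where the result is used.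
    have key (k : ℕ) : ∀ t ∈ Set.Icc (0 : ℝ) 1, (C * A ^ k).mulVec (x t - x' t) = 0 := by
      induction k with
      | zero =>
        intro t ht
        rw [pow_zero, Matrix.mul_one, Matrix.mulVec_sub, hy t ht, sub_self]
      | succ k ih =>
        intro t ht
        ext i
        let φ : (n → ℝ) →L[ℝ] ℝ := LinearMap.toContinuousLinearMap
          (LinearMap.proj i ∘ₗ (C * A ^ k).mulVecLin)
        have h1 : HasDerivWithinAt (fun t => φ (x t - x' t)) (φ (A.mulVec (x t - x' t)))
            (Set.Icc 0 1) t :=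
          φ.hasFDerivAt.comp_hasDerivWithinAt t ((he t ht.1).mono Set.Icc_subset_Ici_self)
        have h2 : HasDerivWithinAt (fun t => φ (x t - x' t)) 0 (Set.Icc 0 1) t :=
          (hasDerivWithinAt_const t _ (0 : ℝ)).congr (fun s hs => congrFun (ih s hs) i)
            (congrFun (ih t ht) i)
        have h3 := (uniqueDiffOn_Icc one_pos t ht).eq_deriv _ h1 h2
        rw [pow_succ, ← Matrix.mul_assoc, ← Matrix.mulVec_mulVec]
        exact h3
    have := h (x 0 - x' 0) (mem_unobservable.2 fun k => key k 0 (by simp))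
    rwa [Matrix.mulVec_sub, sub_eq_zero] at this

end StructuredSystem

/-! ### Generic ranks and matchings. -/

namespace StructuredSystem

open Matrix

theorem rank_add_finrank_ker {m n : Type*} [Fintype n] (N : Matrix m n ℝ) :
    N.rank + Module.finrank ℝ N.mulVecLin.ker = Fintype.card n := by
  rw [Matrix.rank, LinearMap.finrank_range_add_finrank_ker, Module.finrank_fintype_fun_eq_card]

theorem rank_le_of_ker_le {m m' n : Type*} [Fintype n] {M : Matrix m n ℝ} {N : Matrix m' n ℝ}
    (h : ∀ v, N *ᵥ v = 0 → M *ᵥ v = 0) : M.rank ≤ N.rank := by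
  have h1 := rank_add_finrank_ker M
  have h2 := rank_add_finrank_ker N
  have h3 : N.mulVecLin.ker ≤ M.mulVecLin.ker := fun v hv => h v hv
  have := Submodule.finrank_mono h3
  omega

/-- By rank-nullity the inclusion of kernels is an equality. This turns a rank condition, which can
be checked at one parameter value and propagated generically, back into the vanishing of
coordinates. -/
theorem ker_le_of_rank_le {m m' n : Type*} [Fintype n] {M : Matrix m n ℝ} {N : Matrix m' n ℝ}
    (h : ∀ v, N *ᵥ v = 0 → M *ᵥ v = 0) (hr : N.rank ≤ M.rank) (v : n → ℝ) (hv : M *ᵥ v = 0) :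
    N *ᵥ v = 0 := by
  have h1 := rank_add_finrank_ker M
  have h2 := rank_add_finrank_ker N
  have h3 : N.mulVecLin.ker ≤ M.mulVecLin.ker := fun v hv => h v hv
  have h4 := Submodule.eq_of_le_of_finrank_le h3 (by omega)
  have : v ∈ N.mulVecLin.ker := h4 ▸ (show v ∈ M.mulVecLin.ker from hv)
  exact this

theorem fromRows_mulVec_eq_zero_iff {m m' n : Type*} [Fintype n] {M : Matrix m n ℝ}
    {N : Matrix m' n ℝ} {v : n → ℝ} :
    Matrix.fromRows M N *ᵥ v = 0 ↔ M *ᵥ v = 0 ∧ N *ᵥ v = 0 := by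
  rw [Matrix.fromRows_mulVec]
  constructor
  · intro h
    exact ⟨funext fun i => congrFun h (Sum.inl i), funext fun i => congrFun h (Sum.inr i)⟩
  · rintro ⟨h, h'⟩
    rw [h, h']
    exact Sum.elim_zero_zero

theorem card_le_rank_of_exists_row {m n : Type*} [Fintype n] [DecidableEq n]
    {N : Matrix m n ℝ} {S : Finset n}
    (h : ∀ j ∈ S, ∃ i, ∀ j' ∈ S, N i j' = if j = j' then 1 else 0) : S.card ≤ N.rank := by
  choose ρ hρ using fun j : {j // j ∈ S} => h j.1 j.2
  have : N.submatrix ρ (fun s : {j // j ∈ S} => s.1) = 1 := by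
    ext s s'
    rw [Matrix.submatrix_apply, hρ s s' s'.2, Matrix.one_apply]
    exact if_congr Subtype.ext_iff.symm rfl rfl
  calc S.card = (N.submatrix ρ (fun s : {j // j ∈ S} => s.1)).rank := by
        rw [this, Matrix.rank_one, Fintype.card_coe]
    _ ≤ N.rank := Matrix.rank_submatrix_le _ _ _

theorem realize_eq {m n : Type*} {M : StructuredMatrix m n} {N : Matrix m n ℝ}
    (h : ∀ i j, M i j = false → N i j = 0) : realize M (fun s => N s.1.1 s.1.2) = N := by
  ext i j
  by_cases hM : M i j = true
  · simp [realize, hM]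
  · simp [realize, hM, h i j (by simpa using hM)]

/-- The rows with index in `X` of the identity matrix. -/
def idRows {n : ℕ} (X : Finset (Fin n)) : Matrix {i // i ∈ X} (Fin n) ℝ :=
  Matrix.of fun i j => if i.1 = j then 1 else 0

theorem idRows_mulVec {n : ℕ} (X : Finset (Fin n)) (v : Fin n → ℝ) (i : {i // i ∈ X}) :
    (idRows X *ᵥ v) i = v i := by
  simp [idRows, Matrix.mulVec, dotProduct]

theorem idRows_mulVec_eq_zero_iff {n : ℕ} {X : Finset (Fin n)} {v : Fin n → ℝ} :
    idRows X *ᵥ v = 0 ↔ ∀ i ∈ X, v i = 0 := by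
  simp only [funext_iff, idRows_mulVec, Pi.zero_apply, Subtype.forall]

/-- The generic rank of `[A; I_X]`. -/
noncomputable def extendedRank {n : ℕ} (A : StructuredMatrix (Fin n) (Fin n))
    (X : Finset (Fin n)) : ℕ :=
  grank (Matrix.fromRows A (structuredId X))

theorem rank_fromRows_idRows_le {n : ℕ} (A : StructuredMatrix (Fin n) (Fin n))
    (X : Finset (Fin n)) (a : Stars A → ℝ) :
    (Matrix.fromRows (realize A a) (idRows X)).rank ≤ extendedRank A X := by
  rw [← realize_eq (M := Matrix.fromRows A (structuredId X))
    (N := Matrix.fromRows (realize A a) (idRows X))]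
  · exact rank_realize_le_grank _ _
  · rintro (i | i) j h
    · simp_all [realize]
    · simp_all [structuredId, idRows]

/-- A realization of `I_X` only scales the unit rows, possibly by zero, so setting its parameters to
one cannot enlarge the kernel. The generic rank thus depends on the parameters of `A` alone. -/
theorem exists_extendedRank_le {n : ℕ} (A : StructuredMatrix (Fin n) (Fin n))
    (X : Finset (Fin n)) :
    ∃ a, extendedRank A X ≤ (Matrix.fromRows (realize A a) (idRows X)).rank := by
  obtain ⟨θ, hθ⟩ := exists_rank_realize_eq_grank (Matrix.fromRows A (structuredId X))
  refine ⟨fun s => θ ⟨(Sum.inl s.1.1, s.1.2), s.2⟩, ?_⟩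
  rw [extendedRank, ← hθ]
  refine rank_le_of_ker_le fun v hv => ?_
  rw [fromRows_mulVec_eq_zero_iff, idRows_mulVec_eq_zero_iff] at hv
  ext (i | i)
  · exact congrFun hv.1 i
  · rw [Matrix.mulVec, dotProduct]
    refine Finset.sum_eq_zero fun j _ => ?_
    by_cases hij : i.1 = j
    · rw [← hij, hv.2 i i.2, mul_zero]
    · simp [realize, structuredId, hij]

theorem eventually_rank_fromRows_idRows {n : ℕ} (A : StructuredMatrix (Fin n) (Fin n))
    (X : Finset (Fin n)) : ∀ᶠ a in generic (Stars A),
      (Matrix.fromRows (realize A a) (idRows X)).rank = extendedRank A X := by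
  obtain ⟨a₀, h₀⟩ := exists_extendedRank_le A X
  have hp : ∀ i j, (fun a => Matrix.fromRows (realize A a) (idRows X) i j) ∈ polyFun (Stars A) := by
    rintro (i | i) j
    · exact realize_mem_polyFun A i j
    · exact const_mem_polyFun _
  filter_upwards [eventually_rank_le hp a₀] with a ha
  exact le_antisymm (rank_fromRows_idRows_le A X a) (h₀.trans ha)

/-- A set of columns that are linearly independent in some realization is right-matched by
some matching. -/
theorem exists_isMatching_of_linearIndepOn {n : ℕ} {A : StructuredMatrix (Fin n) (Fin n)}
    {a : Stars A → ℝ} {R : Finset (Fin n)}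
    (h : LinearIndepOn ℝ (realize A a).col (R : Set (Fin n))) :
    ∃ M, IsMatching A M ∧ rightMatched M = R := by
  let t : {j // j ∈ R} → Finset (Fin n) := fun j => Finset.univ.filter fun i => A i j = true
  -- Hall's condition: the independent columns in `s` are supported on the rows adjacent to `s`, so
  -- there are at least `s.card` such rows. The rows dropped below are zero.
  have hall : ∀ s : Finset {j // j ∈ R}, s.card ≤ (s.biUnion t).card := by
    intro s
    have hli : LinearIndependent ℝ ((realize A a).submatrix id fun j : s => j.1.1).col :=
      (LinearIndependent.comp (v := fun j : {j // j ∈ R} => (realize A a).col j) h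
        (fun j : s => j.1) Subtype.val_injective)
    have hr : ((realize A a).submatrix id fun j : s => j.1.1).rank = s.card := by
      rw [Matrix.rank_eq_finrank_span_cols, finrank_span_eq_card hli, Fintype.card_coe]
    rw [← hr]
    have hle : ((realize A a).submatrix id fun j : s => j.1.1).rank ≤
        ((realize A a).submatrix (fun i : {i // i ∈ s.biUnion t} => i.1)
          fun j : s => j.1.1).rank := by
      refine rank_le_of_ker_le fun v hv => funext fun i => ?_
      by_cases hi : i ∈ s.biUnion t
      · exact congrFun hv ⟨i, hi⟩
      · rw [Matrix.mulVec, dotProduct]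
        refine Finset.sum_eq_zero fun j _ => ?_
        have hA : A i j.1.1 = false := by
          by_contra hA
          exact hi (Finset.mem_biUnion.2 ⟨j.1, j.2, by simpa [t] using hA⟩)
        simp [realize, hA]
    refine hle.trans ((Matrix.rank_le_card_height _).trans_eq (Fintype.card_coe _))
  obtain ⟨f, hf, hft⟩ := (Finset.all_card_le_biUnion_card_iff_exists_injective t).1 hall
  refine ⟨Finset.univ.image fun j => (j.1, f j), ⟨?_, ?_⟩, ?_⟩
  · intro e he
    obtain ⟨j, -, rfl⟩ := Finset.mem_image.1 he
    simpa [edges, t] using hft j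
  · intro e he e' he' hne
    obtain ⟨j, -, rfl⟩ := Finset.mem_image.1 he
    obtain ⟨j', -, rfl⟩ := Finset.mem_image.1 he'
    have : j ≠ j' := fun h => hne (by rw [h])
    exact ⟨fun h => this (Subtype.ext h), fun h => this (hf h)⟩
  · ext j
    simp [rightMatched]

theorem IsMatching.card_rightMatched {n : ℕ} {A : StructuredMatrix (Fin n) (Fin n)}
    {M : Finset (Fin n × Fin n)} (h : IsMatching A M) : (rightMatched M).card = M.card :=
  Finset.card_image_of_injOn fun e he f hf hef => by
    by_contra hne
    exact (h.2 e he f hf hne).1 hef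

/-- The parameters that give the value one to the edges of `M` and zero to the others. -/
def matchingParameters {n : ℕ} (A : StructuredMatrix (Fin n) (Fin n))
    (M : Finset (Fin n × Fin n)) : Stars A → ℝ :=
  fun s => if (s.1.2, s.1.1) ∈ M then 1 else 0

theorem realize_matchingParameters {n : ℕ} {A : StructuredMatrix (Fin n) (Fin n)}
    {M : Finset (Fin n × Fin n)} (h : IsMatching A M) (i j : Fin n) :
    realize A (matchingParameters A M) i j = if (j, i) ∈ M then 1 else 0 := by
  by_cases hM : (j, i) ∈ M
  · have : A i j = true := by simpa [edges] using h.1 hM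
    simp [realize, matchingParameters, hM, this]
  · simp [realize, matchingParameters, hM]

/-- With ones on `M` and zeros elsewhere, each matched row of `A` is a unit vector. Together with
the unit rows of `B` these form an identity submatrix. A general `B` covers both `I_X` and the
sensors placed by the algorithm. -/
theorem IsMatching.card_add_card_le_rank {n : ℕ} {A : StructuredMatrix (Fin n) (Fin n)}
    {M : Finset (Fin n × Fin n)} (hM : IsMatching A M) {q : Type*} {B : Matrix q (Fin n) ℝ}
    {U : Finset (Fin n)} (hU : Disjoint U (rightMatched M))
    (hB : ∀ u ∈ U, ∃ k, ∀ j, B k j = if u = j then 1 else 0) :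
    M.card + U.card ≤
      (Matrix.fromRows (realize A (matchingParameters A M)) B).rank := by
  rw [← hM.card_rightMatched, add_comm, ← Finset.card_union_of_disjoint hU]
  refine card_le_rank_of_exists_row fun j hj => ?_
  rcases Finset.mem_union.1 hj with hj | hj
  · obtain ⟨k, hk⟩ := hB j hj
    exact ⟨Sum.inr k, fun j' _ => hk j'⟩
  · obtain ⟨⟨j₁, i⟩, he, rfl⟩ := Finset.mem_image.1 hj
    refine ⟨Sum.inl i, fun j' _ => ?_⟩
    rw [Matrix.fromRows_apply_inl, realize_matchingParameters hM]
    by_cases hjj : j₁ = j'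
    · subst hjj
      simp [he]
    · have : (j', i) ∉ M := fun he' =>
        (hM.2 _ he _ he' (by simp [hjj])).2 rfl
      simp [this, hjj]

theorem IsMatching.card_le_grank {n : ℕ} {A : StructuredMatrix (Fin n) (Fin n)}
    {M : Finset (Fin n × Fin n)} (hM : IsMatching A M) : M.card ≤ grank A := by
  have h := hM.card_add_card_le_rank (U := ∅) (B := (0 : Matrix Empty (Fin n) ℝ)) (by simp)
    (by simp)
  refine (h.trans (rank_le_of_ker_le fun v hv => ?_)).trans
    (rank_realize_le_grank A (matchingParameters A M))
  exact fromRows_mulVec_eq_zero_iff.2 ⟨hv, funext fun i => i.elim⟩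

theorem IsMatching.card_add_card_sdiff_le {n : ℕ} {A : StructuredMatrix (Fin n) (Fin n)}
    {M : Finset (Fin n × Fin n)} (hM : IsMatching A M) {X U : Finset (Fin n)} (hUX : U ⊆ X)
    (hU : Disjoint U (rightMatched M)) : M.card + U.card ≤ extendedRank A X :=
  (hM.card_add_card_le_rank hU (B := idRows X) fun u hu =>
    ⟨⟨u, hUX hu⟩, fun j => by simp [idRows]⟩).trans (rank_fromRows_idRows_le A X _)

/-- Some matching with as many edges as the generic rank leaves at least
`grank [A; I_X] - grank A` elements of `X` right-unmatched. -/
theorem exists_isMatching_card_eq {n : ℕ} (A : StructuredMatrix (Fin n) (Fin n))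
    (X : Finset (Fin n)) :
    ∃ M, IsMatching A M ∧ M.card = grank A ∧
      extendedRank A X ≤ grank A + (X \ rightMatched M).card := by
  classical
  obtain ⟨a, hν, hμ⟩ := ((eventually_rank_eq_grank A).and
    (eventually_rank_fromRows_idRows A X)).exists
  set v := (realize A a).col
  -- A basis `Z` of the columns outside `X` is extended to a basis `R` of all columns, which then
  -- uses as few columns in `X` as possible.
  obtain ⟨Z, hZX, -, hZspan, hZ⟩ := exists_linearIndepOn_extension
    (linearIndepOn_empty ℝ v) (Set.empty_subset ((X : Set (Fin n))ᶜ))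
  obtain ⟨R, -, hZR, hRspan, hR⟩ := exists_linearIndepOn_extension hZ (Set.subset_univ Z)
  lift Z to Finset (Fin n) using Set.toFinite Z
  lift R to Finset (Fin n) using Set.toFinite R
  obtain ⟨M, hM, rfl⟩ := exists_isMatching_of_linearIndepOn hR
  have hcard : (rightMatched M).card = grank A := by
    rw [← hν, Matrix.rank_eq_finrank_span_cols]
    have hs : Submodule.span ℝ (Set.range (realize A a).col) =
        Submodule.span ℝ (v '' (rightMatched M : Set (Fin n))) := by
      refine le_antisymm (Submodule.span_le.2 ?_) (Submodule.span_mono (Set.image_subset_range _ _))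
      rwa [← Set.image_univ]
    rw [hs, Set.image_eq_range]
    exact ((finrank_span_eq_card hR).trans (by simp)).symm
  refine ⟨M, hM, hM.card_rightMatched.symm.trans hcard, ?_⟩
  -- Outside `X`, the columns of `[A; I_X]` are those of `A` padded with zeros, hence spanned by the
  -- ones in `Z`; the columns in `X` add at most `X.card`.
  have hXZ : extendedRank A X ≤ X.card + Z.card := by
    rw [← hμ, Matrix.rank_eq_finrank_span_cols]
    set w := (Matrix.fromRows (realize A a) (idRows X)).col
    let ι : (Fin n → ℝ) →ₗ[ℝ] (Fin n ⊕ {i // i ∈ X} → ℝ) :=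
      { toFun := fun u => Sum.elim u 0
        map_add' := fun u u' => by ext (i | i) <;> simp
        map_smul' := fun c u => by ext (i | i) <;> simp }
    have hw : ∀ j ∉ X, w j = ι (v j) := by
      intro j hj
      ext (i | i)
      · rfl
      · have : i.1 ≠ j := fun h => hj (h ▸ i.2)
        simp [w, ι, idRows, Matrix.col, this]
    have hle : Submodule.span ℝ (Set.range w) ≤
        Submodule.span ℝ (((X ∪ Z).image w : Finset _) : Set _) := by
      refine Submodule.span_le.2 ?_
      rintro _ ⟨j, rfl⟩
      by_cases hj : j ∈ X
      · exact Submodule.subset_span (by simpa using ⟨j, Or.inl hj, rfl⟩)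
      · rw [hw j hj]
        have h1 : v j ∈ Submodule.span ℝ (v '' (Z : Set (Fin n))) :=
          hZspan ⟨j, by simpa using hj, rfl⟩
        have h2 := Submodule.mem_map_of_mem (f := ι) h1
        rw [Submodule.map_span] at h2
        refine Submodule.span_mono ?_ h2
        rintro _ ⟨_, ⟨z, hz, rfl⟩, rfl⟩
        rw [← hw z (by simpa using hZX hz)]
        simpa using ⟨z, Or.inr hz, rfl⟩
    calc _ ≤ _ := Submodule.finrank_mono hle
      _ ≤ ((X ∪ Z).image w).card := finrank_span_finset_le_card _
      _ ≤ (X ∪ Z).card := Finset.card_image_le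
      _ ≤ X.card + Z.card := Finset.card_union_le _ _
  have hdisj : Disjoint (X ∩ rightMatched M) Z := by
    rw [Finset.disjoint_left]
    intro j hj hjZ
    exact hZX hjZ (Finset.mem_inter.1 hj).1
  -- The basis contains the disjoint sets `X ∩ R` and `Z`, so `Z.card ≤ grank A - (X ∩ R).card`,
  -- which is substituted into `hXZ`.
  have h3 : (X ∩ rightMatched M ∪ Z).card ≤ (rightMatched M).card :=
    Finset.card_le_card (Finset.union_subset Finset.inter_subset_right
      (by exact_mod_cast hZR))
  rw [Finset.card_union_of_disjoint hdisj] at h3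
  have h4 := Finset.card_sdiff_add_card_inter X (rightMatched M)
  omega

theorem IsMaximumMatching.card_eq {n : ℕ} {A : StructuredMatrix (Fin n) (Fin n)}
    {M : Finset (Fin n × Fin n)} (h : IsMaximumMatching A M) : M.card = grank A := by
  obtain ⟨M', hM', hc, -⟩ := exists_isMatching_card_eq A ∅
  exact le_antisymm h.1.card_le_grank (hc ▸ h.2 M' hM')

theorem isMaximumMatching_of_card_eq {n : ℕ} {A : StructuredMatrix (Fin n) (Fin n)}
    {M : Finset (Fin n × Fin n)} (h : IsMatching A M) (hc : M.card = grank A) :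
    IsMaximumMatching A M :=
  ⟨h, fun _ hM' => hc ▸ hM'.card_le_grank⟩

theorem IsMatching.weight_eq {n : ℕ} {A : StructuredMatrix (Fin n) (Fin n)}
    {M : Finset (Fin n × Fin n)} (h : IsMatching A M) (X : Finset (Fin n)) :
    weight X M = (X ∩ rightMatched M).card := by
  have : X ∩ rightMatched M = (M.filter fun e => e.1 ∈ X).image Prod.fst := by
    ext j
    simp only [rightMatched, Finset.mem_inter, Finset.mem_image, Finset.mem_filter]
    constructor
    · rintro ⟨hj, e, he, rfl⟩
      exact ⟨e, ⟨he, hj⟩, rfl⟩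
    · rintro ⟨e, ⟨he, hj⟩, rfl⟩
      exact ⟨hj, e, he, rfl⟩
  rw [weight, ← Finset.card_filter, this, Finset.card_image_of_injOn]
  intro e he f hf hef
  by_contra hne
  exact (h.2 e (Finset.mem_filter.1 he).1 f (Finset.mem_filter.1 hf).1 hne).1 hef

theorem exists_isMinWeightMaximumMatching {n : ℕ} (A : StructuredMatrix (Fin n) (Fin n))
    (X : Finset (Fin n)) : ∃ M, IsMinWeightMaximumMatching A X M := by
  classical
  obtain ⟨M', hM', hc, -⟩ := exists_isMatching_card_eq A X
  obtain ⟨M, hM, hmin⟩ := Finset.exists_min_image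
    (Finset.univ.filter fun M => IsMaximumMatching A M) (weight X)
    ⟨M', by simpa using isMaximumMatching_of_card_eq hM' hc⟩
  exact ⟨M, by simpa using hM, fun N hN => hmin N (by simpa using hN)⟩

/-- The weight is the number of matched elements of `X`, so minimizing it maximizes the unmatched
ones. The rank gap bounds their number above, and the matching of `exists_isMatching_card_eq`
reaches it. -/
theorem IsMinWeightMaximumMatching.card_sdiff {n : ℕ} {A : StructuredMatrix (Fin n) (Fin n)}
    {X : Finset (Fin n)} {M : Finset (Fin n × Fin n)} (h : IsMinWeightMaximumMatching A X M) :
    grank A + (X \ rightMatched M).card = extendedRank A X := by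
  obtain ⟨M', hM', hc, hle⟩ := exists_isMatching_card_eq A X
  have h1 := h.2 M' (isMaximumMatching_of_card_eq hM' hc)
  rw [h.1.1.weight_eq, hM'.weight_eq] at h1
  have h2 := Finset.card_sdiff_add_card_inter X (rightMatched M)
  have h3 := Finset.card_sdiff_add_card_inter X (rightMatched M')
  have h4 := h.1.1.card_add_card_sdiff_le (X := X) Finset.sdiff_subset Finset.sdiff_disjoint
  rw [h.1.card_eq] at h4
  omega

theorem IsRightUnmatchedSubset.card_le {n : ℕ} {A : StructuredMatrix (Fin n) (Fin n)}
    {X S : Finset (Fin n)} (h : IsRightUnmatchedSubset A X S) :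
    grank A + S.card ≤ extendedRank A X := by
  obtain ⟨hSX, M, hM, hd⟩ := h
  rw [← hM.card_eq]
  exact hM.1.card_add_card_sdiff_le hSX hd

theorem exists_isRightUnmatchedSubset_card_eq {n : ℕ} (A : StructuredMatrix (Fin n) (Fin n))
    (X : Finset (Fin n)) :
    ∃ S, IsRightUnmatchedSubset A X S ∧ grank A + S.card = extendedRank A X := by
  obtain ⟨M, hM⟩ := exists_isMinWeightMaximumMatching A X
  exact ⟨X \ rightMatched M, ⟨Finset.sdiff_subset, M, hM.1, Finset.sdiff_disjoint⟩, hM.card_sdiff⟩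

theorem exists_isLargestRightUnmatchedSubset {n : ℕ} (A : StructuredMatrix (Fin n) (Fin n))
    (X : Finset (Fin n)) : ∃ S, IsLargestRightUnmatchedSubset A X S := by
  obtain ⟨S, hS, hc⟩ := exists_isRightUnmatchedSubset_card_eq A X
  exact ⟨S, hS, fun S' hS' => by have := hS'.card_le; omega⟩

theorem IsLargestRightUnmatchedSubset.card_eq {n : ℕ} {A : StructuredMatrix (Fin n) (Fin n)}
    {X S : Finset (Fin n)} (h : IsLargestRightUnmatchedSubset A X S) :
    S.card = extendedRank A X - grank A := by
  obtain ⟨S', hS', hc⟩ := exists_isRightUnmatchedSubset_card_eq A X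
  have h1 := h.2 S' hS'
  have h2 := h.1.card_le
  omega

end StructuredSystem

/-! ### Generic simplicity of the nonzero eigenvalues. -/

namespace StructuredSystem

open Polynomial

/-- The generic realization of `A`, with the parameters as indeterminates. -/
noncomputable def genericMatrix {n : Type*} (A : StructuredMatrix n n) :
    Matrix n n (MvPolynomial (Stars A) ℝ) :=
  Matrix.of fun i j => if h : A i j = true then MvPolynomial.X ⟨(i, j), h⟩ else 0

theorem genericMatrix_map_eval {n : Type*} (A : StructuredMatrix n n) (a : Stars A → ℝ) :
    (genericMatrix A).map (MvPolynomial.eval a) = realize A a := by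
  ext i j
  by_cases h : A i j = true <;> simp [genericMatrix, realize, h]

theorem charpoly_genericMatrix_map_eval {n : Type*} [Fintype n] [DecidableEq n]
    (A : StructuredMatrix n n) (a : Stars A → ℝ) :
    (genericMatrix A).charpoly.map (MvPolynomial.eval a) = (realize A a).charpoly := by
  rw [← genericMatrix_map_eval, Matrix.charpoly_map]

/-- Each parameter occurs in a single entry. Through `optionEquivLeft` the polynomial variable
becomes the indeterminate `none`, so that degrees in one parameter `some e` make sense. -/
theorem degreeOf_charmatrix_le {n : Type*} [Fintype n] [DecidableEq n] (A : StructuredMatrix n n)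
    (e : Stars A) (i j : n) :
    ((MvPolynomial.optionEquivLeft ℝ (Stars A)).symm
      ((genericMatrix A).charmatrix i j)).degreeOf (some e) ≤ if (i, j) = e.1 then 1 else 0 := by
  rw [Matrix.charmatrix_apply, map_sub]
  refine (MvPolynomial.degreeOf_sub_le _ _ _).trans (max_le ?_ ?_)
  · by_cases hij : i = j
    · simp [hij, Matrix.diagonal, MvPolynomial.degreeOf_X]
    · simp [hij, Matrix.diagonal]
  · by_cases h : A i j = true
    · rw [genericMatrix, Matrix.of_apply, dif_pos h, MvPolynomial.optionEquivLeft_symm_C_X,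
        MvPolynomial.degreeOf_X]
      simp [Subtype.ext_iff, eq_comm]
    · simp [genericMatrix, h]

/-- The generic characteristic polynomial is affine in every parameter. -/
theorem degreeOf_charpoly_le {n : Type*} [Fintype n] [DecidableEq n] (A : StructuredMatrix n n)
    (e : Stars A) :
    ((MvPolynomial.optionEquivLeft ℝ (Stars A)).symm
      (genericMatrix A).charpoly).degreeOf (some e) ≤ 1 := by
  rw [Matrix.charpoly, Matrix.det_apply, map_sum]
  refine (MvPolynomial.degreeOf_sum_le _ _ _).trans (Finset.sup_le fun π _ => ?_)
  have h1 : ((MvPolynomial.optionEquivLeft ℝ (Stars A)).symm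
      (∏ i, (genericMatrix A).charmatrix (π i) i)).degreeOf (some e) ≤ 1 := by
    rw [map_prod]
    refine (MvPolynomial.degreeOf_prod_le _ _ _).trans
      ((Finset.sum_le_sum fun i _ => degreeOf_charmatrix_le A e (π i) i).trans ?_)
    -- A term of the Leibniz formula takes one entry per column, so it meets the position of `e` at
    -- most once.
    rw [← Finset.card_filter, Finset.card_le_one]
    intro i hi j hj
    rw [Finset.mem_filter] at hi hj
    exact (Prod.ext_iff.1 (hi.2.trans hj.2.symm)).2
  rcases Int.units_eq_one_or (Equiv.Perm.sign π) with h | h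
  · rwa [h, one_smul]
  · rwa [h, Units.neg_smul, one_smul, map_neg, MvPolynomial.degreeOf_neg]

/-- A nonconstant monic polynomial whose square divides the generic characteristic polynomial is
divisible by the variable. -/
theorem X_dvd_of_mul_self_dvd_charpoly {n : Type*} [Fintype n] [DecidableEq n]
    {A : StructuredMatrix n n} {h : (MvPolynomial (Stars A) ℝ)[X]} (hm : h.Monic)
    (hd : h * h ∣ (genericMatrix A).charpoly) (hdeg : h.natDegree ≠ 0) : X ∣ h := by
  set ψ := MvPolynomial.optionEquivLeft ℝ (Stars A)
  obtain ⟨k, hk⟩ := hd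
  have hF : (genericMatrix A).charpoly ≠ 0 := (Matrix.charpoly_monic _).ne_zero
  have hk0 : k ≠ 0 := by
    rintro rfl
    exact hF (by rw [hk, mul_zero])
  -- Degrees add in a domain, so twice the degree of `h` in `e` is at most one.
  have hdeg0 (e : Stars A) : (ψ.symm h).degreeOf (some e) = 0 := by
    have h1 := degreeOf_charpoly_le A e
    have hh : ψ.symm h ≠ 0 := by simpa using hm.ne_zero
    have hkk : ψ.symm k ≠ 0 := by simpa using hk0
    rw [hk, map_mul, map_mul, MvPolynomial.degreeOf_mul_eq (mul_ne_zero hh hh) hkk,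
      MvPolynomial.degreeOf_mul_eq hh hh] at h1
    omega
  have hconst (a : Stars A → ℝ) : h.map (MvPolynomial.eval a) = h.map (MvPolynomial.eval 0) := by
    refine Polynomial.funext fun x => ?_
    have key (b : Stars A → ℝ) := MvPolynomial.optionEquivLeft_elim_eval ℝ (Stars A) b x (ψ.symm h)
    rw [show MvPolynomial.optionEquivLeft ℝ (Stars A) (ψ.symm h) = h from ψ.apply_symm_apply h]
      at key
    rw [← key a, ← key 0]
    refine MvPolynomial.eval₂Hom_congr' rfl (fun i hi _ => ?_) rfl
    cases i with
    | none => rfl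
    | some e =>
      exact absurd (hdeg0 e) (MvPolynomial.mem_vars_iff_degreeOf_ne_zero.1 hi)
  -- At the zero parameter the matrix is zero and its characteristic polynomial is a power of `X`;
  -- by `hconst` every specialization of `h` is the same.
  have hpow : h.map (MvPolynomial.eval 0) ∣ (X : ℝ[X]) ^ Fintype.card n := by
    have h0 : realize A 0 = 0 := by
      ext i j
      simp [realize]
    have := Polynomial.map_dvd (MvPolynomial.eval (0 : Stars A → ℝ))
      (Dvd.intro (h * k) ((mul_assoc h h k).symm.trans hk.symm) : h ∣ (genericMatrix A).charpoly)
    rwa [charpoly_genericMatrix_map_eval, h0, Matrix.charpoly_zero] at this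
  obtain ⟨j, -, hj⟩ := (dvd_prime_pow Polynomial.prime_X _).1 hpow
  have hj' := eq_of_monic_of_associated (hm.map _) (monic_X_pow j) hj
  have hj0 : j ≠ 0 := by
    rintro rfl
    rw [← hm.natDegree_map (MvPolynomial.eval (0 : Stars A → ℝ)), hj'] at hdeg
    simp at hdeg
  rw [Polynomial.X_dvd_iff]
  refine MvPolynomial.funext fun a => ?_
  rw [map_zero, ← Polynomial.coeff_map, hconst, hj', Polynomial.coeff_X_pow, if_neg hj0.symm]

/-- A monic polynomial over an integrally closed domain without nontrivial monic square factors is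
squarefree over the field of fractions. -/
theorem squarefree_map_of_monic {R K : Type*} [CommRing R] [IsDomain R] [IsIntegrallyClosed R]
    [Field K] [Algebra R K] [IsFractionRing R K] {g : R[X]} (hg : g.Monic)
    (H : ∀ h : R[X], h.Monic → h * h ∣ g → h = 1) : Squarefree (g.map (algebraMap R K)) := by
  have hinj : Function.Injective (algebraMap R K) := IsFractionRing.injective R K
  intro x hx
  have hx0 : x ≠ 0 := by
    rintro rfl
    exact (hg.map (algebraMap R K)).ne_zero (by simpa using hx)
  -- Gauss's lemma: up to its leading coefficient, a factor over the fraction field comes from `R`.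
  obtain ⟨h, hh⟩ := IsIntegrallyClosed.eq_map_mul_C_of_dvd K hg (dvd_of_mul_left_dvd hx)
  have hlc : x.leadingCoeff ≠ 0 := leadingCoeff_ne_zero.2 hx0
  have hmon : h.Monic := by
    refine monic_of_injective hinj (mul_right_cancel₀ hlc ?_)
    rw [one_mul, ← leadingCoeff_C x.leadingCoeff, ← leadingCoeff_mul, hh, leadingCoeff_C]
  have hdvd : h * h ∣ g := by
    rw [← map_dvd_map (algebraMap R K) hinj (hmon.mul hmon), Polynomial.map_mul]
    have : h.map (algebraMap R K) ∣ x := Dvd.intro _ hh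
    exact (mul_dvd_mul this this).trans hx
  rw [H h hmon hdvd, Polynomial.map_one, one_mul] at hh
  exact hh ▸ isUnit_C.2 hlc.isUnit

/-- A Bézout identity for a polynomial and its derivative, without denominators. -/
theorem exists_bezout_of_separable_map {R K : Type*} [CommRing R] [IsDomain R] [Field K]
    [Algebra R K] [IsFractionRing R K] {g : R[X]} (hg : (g.map (algebraMap R K)).Separable) :
    ∃ (u w : R[X]) (D : R), D ≠ 0 ∧ u * g + w * derivative g = C D := by
  obtain ⟨a, b, hab⟩ := hg
  obtain ⟨s, hs, ha⟩ := IsLocalization.integerNormalization_spec (nonZeroDivisors R) a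
  obtain ⟨t, ht, hb⟩ := IsLocalization.integerNormalization_spec (nonZeroDivisors R) b
  refine ⟨C t * IsLocalization.integerNormalization (nonZeroDivisors R) a,
    C s * IsLocalization.integerNormalization (nonZeroDivisors R) b, s * t,
    mul_ne_zero (nonZeroDivisors.ne_zero hs) (nonZeroDivisors.ne_zero ht), ?_⟩
  refine map_injective _ (IsFractionRing.injective R K) ?_
  rw [algebra_compatible_smul K, smul_eq_C_mul] at ha hb
  rw [derivative_map] at hab
  simp only [Polynomial.map_add, Polynomial.map_mul, map_C, ha, hb, map_mul]
  linear_combination (C (algebraMap R K s) * C (algebraMap R K t)) * hab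

/-- The generic characteristic polynomial is a power of the variable times a polynomial that is
separable over the field of rational functions of the parameters. -/
theorem exists_charpoly_eq {n : Type*} [Fintype n] [DecidableEq n] (A : StructuredMatrix n n) :
    ∃ (m : ℕ) (g u w : (MvPolynomial (Stars A) ℝ)[X]) (D : MvPolynomial (Stars A) ℝ),
      (genericMatrix A).charpoly = X ^ m * g ∧ D ≠ 0 ∧ u * g + w * derivative g = C D := by
  have hF := Matrix.charpoly_monic (genericMatrix A)
  obtain ⟨g, hg, hXg⟩ := exists_eq_pow_rootMultiplicity_mul_and_not_dvd _ hF.ne_zero 0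
  rw [C_0, sub_zero] at hg hXg
  have hgm : g.Monic := (monic_X_pow _).of_mul_monic_left (hg ▸ hF)
  -- The full power of `X` has been divided out, while every repeated monic factor is divisible by
  -- `X`. In characteristic zero, squarefree then gives separable.
  have hsq : Squarefree (g.map (algebraMap _ (FractionRing (MvPolynomial (Stars A) ℝ)))) := by
    refine squarefree_map_of_monic hgm fun h hmon hdvd => ?_
    by_contra hne
    refine hXg (dvd_trans ?_ (dvd_of_mul_left_dvd hdvd))
    exact X_dvd_of_mul_self_dvd_charpoly hmon (hdvd.trans (Dvd.intro_left _ hg.symm))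
      fun h0 => hne (hmon.natDegree_eq_zero.1 h0)
  obtain ⟨u, w, D, hD, huw⟩ :=
    exists_bezout_of_separable_map (PerfectField.separable_iff_squarefree.2 hsq)
  exact ⟨_, g, u, w, D, hg, hD, huw⟩

/-- Generically, the nonzero eigenvalues are simple. -/
theorem eventually_not_sq_dvd_charpoly {n : Type*} [Fintype n] [DecidableEq n]
    (A : StructuredMatrix n n) : ∀ᶠ a in generic (Stars A), ∀ z : ℂ, z ≠ 0 →
      ¬ (X - C z) ^ 2 ∣ (realize A a).charpoly.map Complex.ofRealHom := by
  obtain ⟨m, g, u, w, D, hg, hD, huw⟩ := exists_charpoly_eq A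
  refine eventually_generic_iff.2 ⟨D, hD, fun a ha z hz hdvd => ?_⟩
  let φ : MvPolynomial (Stars A) ℝ →+* ℂ := Complex.ofRealHom.comp (MvPolynomial.eval a)
  rw [← charpoly_genericMatrix_map_eval, Polynomial.map_map, hg, Polynomial.map_mul,
    Polynomial.map_pow, map_X] at hdvd
  have hcop : IsCoprime ((X - C z) ^ 2) ((X : ℂ[X]) ^ m) := by
    refine IsCoprime.pow ?_
    have := isCoprime_X_sub_C_of_isUnit_sub (R := ℂ) (a := z) (b := 0) (by simpa using hz)
    simpa using this
  have h1 : (X - C z) ^ 2 ∣ g.map φ := hcop.dvd_of_dvd_mul_left hdvd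
  obtain ⟨k, hk⟩ := h1
  rw [pow_two] at hk
  -- The Bézout identity survives specialization. At a double root both `g` and its derivative
  -- vanish, which forces `D` to vanish at `a`.
  have h2 := congrArg (fun p => (p.map φ).eval z) huw
  simp only [Polynomial.map_add, Polynomial.map_mul, ← derivative_map, hk, map_C, eval_add,
    eval_mul, eval_C, derivative_mul] at h2
  have : φ D = 0 := by simpa using h2.symm
  exact ha (by simpa [φ] using this)

end StructuredSystem

/-! ### Necessity: the lower bound on the number of sensors. -/

namespace StructuredSystem

open Matrix

theorem mem_functionalStates {n r : ℕ} {F : StructuredMatrix (Fin r) (Fin n)} {i : Fin n} :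
    i ∈ functionalStates F ↔ ∃ k, F k i = true := by
  simp [functionalStates]

/-- A single nonzero parameter isolates one coordinate; it is the test point for polynomials in the
parameters of a row. -/
theorem realize_single_mulVec {q n : Type*} [Fintype n] [DecidableEq n] [DecidableEq q]
    {C : StructuredMatrix q n} {R : Type*} [CommRing R] [Algebra ℝ R] {k : q} {x : n}
    (h : C k x = true) (v : n → R) :
    ∑ j, realize C (fun s => if s.1 = (k, x) then 1 else 0) k j • v j = v x := by
  rw [Finset.sum_eq_single x]
  · simp [realize, h]
  · intro j _ hj
    by_cases hC : C k j = true <;> simp [realize, hC, hj]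
  · simp

theorem realize_mulVec_eq_zero {q n : Type*} [Fintype n] {C : StructuredMatrix q n}
    {c : Stars C → ℝ} {v : n → ℝ} (h : ∀ k j, C k j = true → v j = 0) :
    realize C c *ᵥ v = 0 := by
  ext k
  rw [Matrix.mulVec, dotProduct]
  refine Finset.sum_eq_zero fun j _ => ?_
  by_cases hkj : C k j = true
  · rw [h k j hkj, mul_zero]
  · simp [realize, hkj]

/-- If `(A, C, F)` is structurally functionally observable, the functional states vanish on the
unobservable subspace of a generic realization of `(A, C)`. -/
theorem SFO.eventually_eq_zero {n r : ℕ} {q : Type*} {A : StructuredMatrix (Fin n) (Fin n)}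
    {C : StructuredMatrix q (Fin n)} {F : StructuredMatrix (Fin r) (Fin n)} (h : SFO A C F) :
    ∀ᶠ a in generic (Stars A), ∀ᶠ c in generic (Stars C),
      ∀ v ∈ unobservable (realize A a) (realize C c), ∀ x ∈ functionalStates F, v x = 0 := by
  filter_upwards [eventually_sum (sfo_iff.1 h)] with a ha
  filter_upwards [eventually_sum ha] with c hc v hv x hx
  obtain ⟨k, hk⟩ := mem_functionalStates.1 hx
  have hp : (fun f => ∑ j, realize F f k j • v j) ∈ polyFun (Stars F) :=
    sum_mem_polyFun fun j _ => mul_mem_polyFun (realize_mem_polyFun F k j) (const_mem_polyFun _)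
  rw [← realize_single_mulVec hk v]
  -- For fixed `v`, a row of `F v` is a polynomial in the parameters of `F`. Vanishing generically,
  -- it vanishes everywhere, in particular where it equals `v x`.
  refine eq_zero_of_eventually hp ?_ _
  filter_upwards [hc] with f hf
  exact congrFun (functionallyObservable_iff.1 hf v hv) k

theorem rank_fromRows_le {m p n : Type*} [Finite m] [Fintype p] [Fintype n] (M : Matrix m n ℝ)
    (N : Matrix p n ℝ) : (Matrix.fromRows M N).rank ≤ M.rank + Fintype.card p := by
  have h : Submodule.span ℝ (Set.range (Matrix.fromRows M N).row) ≤
      Submodule.span ℝ (Set.range M.row) ⊔ Submodule.span ℝ (Set.range N.row) := by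
    rw [← Submodule.span_union]
    refine Submodule.span_mono ?_
    rintro _ ⟨i | i, rfl⟩
    · exact Or.inl ⟨i, rfl⟩
    · exact Or.inr ⟨i, rfl⟩
  calc _ = _ := Matrix.rank_eq_finrank_span_row _
    _ ≤ _ := Submodule.finrank_mono h
    _ ≤ _ := Submodule.finrank_add_le_finrank_add_finrank _ _
    _ ≤ _ := by
      rw [← Matrix.rank_eq_finrank_span_row, ← Matrix.rank_eq_finrank_span_row]
      exact Nat.add_le_add_left (Matrix.rank_le_card_height N) _

theorem mem_unobservable_of_mulVec_eq_zero {n p : Type*} [Fintype n] [DecidableEq n]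
    {A : Matrix n n ℝ} {C : Matrix p n ℝ} {v : n → ℝ} (hA : A *ᵥ v = 0) (hC : C *ᵥ v = 0) :
    v ∈ unobservable A C := by
  rw [mem_unobservable]
  rintro (_ | k)
  · simpa using hC
  · rw [pow_succ, ← Matrix.mul_assoc, ← Matrix.mulVec_mulVec, hA, Matrix.mulVec_zero]

/-- The lower bound on the number of sensors. -/
theorem SFO.extendedRank_le {n r p : ℕ} {A : StructuredMatrix (Fin n) (Fin n)}
    {C : StructuredMatrix (Fin p) (Fin n)} {F : StructuredMatrix (Fin r) (Fin n)}
    (h : SFO A C F) : extendedRank A (functionalStates F) ≤ grank A + p := by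
  obtain ⟨a, ha, hrank⟩ := (h.eventually_eq_zero.and
    (eventually_rank_fromRows_idRows A (functionalStates F))).exists
  obtain ⟨c, hc⟩ := ha.exists
  calc _ = _ := hrank.symm
    _ ≤ (Matrix.fromRows (realize A a) (realize C c)).rank := by
      refine rank_le_of_ker_le fun v hv => ?_
      rw [fromRows_mulVec_eq_zero_iff] at hv ⊢
      exact ⟨hv.1, idRows_mulVec_eq_zero_iff.2
        (hc v (mem_unobservable_of_mulVec_eq_zero hv.1 hv.2))⟩
    _ ≤ (realize A a).rank + p := (rank_fromRows_le _ _).trans_eq (by rw [Fintype.card_fin])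
    _ ≤ grank A + p := Nat.add_le_add_right (rank_realize_le_grank A a) p

theorem not_sensorsSuffice_zero {n r : ℕ} {A : StructuredMatrix (Fin n) (Fin n)}
    {F : StructuredMatrix (Fin r) (Fin n)} (hF : (functionalStates F).Nonempty) :
    ¬ SensorsSuffice A F 0 := by
  rintro ⟨C, hC⟩
  obtain ⟨x, hx⟩ := hF
  obtain ⟨a, ha⟩ := hC.eventually_eq_zero.exists
  obtain ⟨c, hc⟩ := ha.exists
  -- Without outputs every vector is unobservable, for instance the all-ones vector.
  have := hc 1 (mem_unobservable.2 fun k => Subsingleton.elim _ _) x hx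
  simp at this

/-! ### An observability test in eigencoordinates. -/

/-- By linearity the powers may be replaced by any polynomial, and one vanishing at all values of
`d` other than `z` isolates `z`. -/
theorem sum_filter_eq_zero_of_forall_pow {ι : Type*} [Fintype ι] {γ d : ι → ℂ}
    (h : ∀ k : ℕ, ∑ i, γ i * d i ^ k = 0) (z : ℂ) :
    ∑ i with d i = z, γ i = 0 := by
  classical
  have hp (p : Polynomial ℂ) : ∑ i, γ i * p.eval (d i) = 0 := by
    simp only [Polynomial.eval_eq_sum_range, Finset.mul_sum]
    rw [Finset.sum_comm]
    refine Finset.sum_eq_zero fun k _ => ?_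
    rw [← mul_zero (p.coeff k), ← h k, Finset.mul_sum]
    exact Finset.sum_congr rfl fun i _ => by ring
  set S := (Finset.univ.image d).erase z
  set p : Polynomial ℂ := ∏ y ∈ S, (Polynomial.X - Polynomial.C y)
  have hz : p.eval z ≠ 0 := by
    rw [Polynomial.eval_prod, Finset.prod_ne_zero_iff]
    intro y hy
    simpa [sub_eq_zero] using (Finset.ne_of_mem_erase hy).symm
  have h0 (i : ι) (hi : d i ≠ z) : p.eval (d i) = 0 := by
    rw [Polynomial.eval_prod]
    exact Finset.prod_eq_zero (i := d i) (by simp [S, hi]) (by simp)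
  refine (mul_eq_zero.1 ?_).resolve_right hz
  rw [← hp p, Finset.sum_mul, Finset.sum_filter]
  refine Finset.sum_congr rfl fun i _ => ?_
  split_ifs with hi
  · rw [hi]
  · rw [h0 i hi, mul_zero]

theorem IsDiagonalizable.exists_mul_eq {n : Type*} [Fintype n] [DecidableEq n] {A : Matrix n n ℝ}
    (h : IsDiagonalizable A) : ∃ (P : Matrix n n ℂ) (d : n → ℂ), IsUnit P.det ∧
      A.map Complex.ofReal * P = P * Matrix.diagonal d ∧
      A.charpoly.map Complex.ofRealHom = ∏ i, (Polynomial.X - Polynomial.C (d i)) := by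
  obtain ⟨P, d, hP, hA⟩ := h
  refine ⟨P, d, hP, ?_, ?_⟩
  · rw [hA, Matrix.mul_assoc, Matrix.nonsing_inv_mul _ hP, Matrix.mul_one]
  · rw [← Matrix.charpoly_map]
    change (A.map Complex.ofReal).charpoly = _
    rw [hA, Matrix.charpoly_mul_comm, ← Matrix.mul_assoc, Matrix.nonsing_inv_mul _ hP,
      Matrix.one_mul, Matrix.charpoly_diagonal]

theorem eq_of_not_sq_dvd {ι : Type*} [Fintype ι] {d : ι → ℂ}
    (h : ∀ z : ℂ, z ≠ 0 → ¬ (Polynomial.X - Polynomial.C z) ^ 2 ∣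
      ∏ i, (Polynomial.X - Polynomial.C (d i))) {i j : ι} (hi : d i ≠ 0) (hij : d j = d i) :
    j = i := by
  classical
  by_contra hne
  refine h (d i) hi ?_
  have := Finset.prod_dvd_prod_of_subset {j, i} Finset.univ
    (fun i => Polynomial.X - Polynomial.C (d i)) (Finset.subset_univ _)
  rwa [Finset.prod_pair hne, hij, ← pow_two] at this

theorem map_ofReal_mulVec {q n : Type*} [Fintype n] (M : Matrix q n ℝ) (v : n → ℝ) :
    M.map Complex.ofReal *ᵥ (fun i => (v i : ℂ)) = fun i => ((M *ᵥ v) i : ℂ) := by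
  ext i
  simp [Matrix.mulVec, dotProduct]

theorem mulVec_re_eq_zero {q n : Type*} [Fintype n] {M : Matrix q n ℝ} {u : n → ℂ}
    (h : M.map Complex.ofReal *ᵥ u = 0) :
    M *ᵥ (fun i => (u i).re) = 0 ∧ M *ᵥ (fun i => (u i).im) = 0 := by
  constructor
  · ext i
    have := congrArg Complex.re (congrFun h i)
    simpa [Matrix.mulVec, dotProduct] using this
  · ext i
    have := congrArg Complex.im (congrFun h i)
    simpa [Matrix.mulVec, dotProduct] using this

/-- An observability test for a matrix `A` with `A P = P diag d` all of whose nonzero eigenvalues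
are simple. -/
theorem eq_zero_of_mem_unobservable {q n : Type*} [Fintype n] [DecidableEq n] {A : Matrix n n ℝ}
    {C : Matrix q n ℝ} {P : Matrix n n ℂ} {d : n → ℂ} {x : n} (hP : IsUnit P.det)
    (hA : A.map Complex.ofReal * P = P * Matrix.diagonal d)
    (hd : ∀ i j, d i ≠ 0 → d j = d i → j = i)
    (hker : ∀ v, A *ᵥ v = 0 → C *ᵥ v = 0 → v x = 0)
    (hC : ∀ i, P x i ≠ 0 → ∃ l, (C.map Complex.ofReal * P) l i ≠ 0)
    {v : n → ℝ} (hv : v ∈ unobservable A C) : v x = 0 := by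
  set w : n → ℂ := fun i => (v i : ℂ)
  set β : n → ℂ := P⁻¹ *ᵥ w
  have hw : w = P *ᵥ β := by
    rw [Matrix.mulVec_mulVec, Matrix.mul_nonsing_inv _ hP, Matrix.one_mulVec]
  have hpow (k : ℕ) : A.map Complex.ofReal ^ k * P = P * Matrix.diagonal (d ^ k) := by
    induction k with
    | zero => simp
    | succ k ih =>
      rw [pow_succ, Matrix.mul_assoc, hA, ← Matrix.mul_assoc, ih, Matrix.mul_assoc,
        Matrix.diagonal_mul_diagonal, pow_succ]
      rfl
  have hmap (k : ℕ) : (C * A ^ k).map Complex.ofReal =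
      C.map Complex.ofReal * A.map Complex.ofReal ^ k := by
    have h1 := Matrix.map_mul (L := C) (M := A ^ k) (f := Complex.ofRealHom)
    have h2 := Matrix.map_pow (f := Complex.ofRealHom) A k
    exact h1.trans (congrArg _ h2)
  -- In eigencoordinates `C A^k v` is a sum of `k`-th powers of eigenvalues with fixed coefficients,
  -- so each eigenvalue contributes zero separately.
  have hsum (z : ℂ) (l : q) :
      ∑ i with d i = z, (C.map Complex.ofReal * P) l i * β i = 0 := by
    refine sum_filter_eq_zero_of_forall_pow (fun k => ?_) z
    have h1 := congrFun (map_ofReal_mulVec (C * A ^ k) v) l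
    rw [mem_unobservable.1 hv k, hmap, show (fun i => (v i : ℂ)) = P *ᵥ β from hw,
      Matrix.mulVec_mulVec, Matrix.mul_assoc, hpow, ← Matrix.mul_assoc,
      ← Matrix.mulVec_mulVec] at h1
    rw [Pi.zero_apply, Complex.ofReal_zero] at h1
    rw [← h1, Matrix.mulVec, dotProduct]
    refine Finset.sum_congr rfl fun i _ => ?_
    rw [Matrix.mulVec_diagonal, Pi.pow_apply]
    ring
  -- The component of `v` in `ker A`. It is a complex vector, so `hker` is applied to its real and
  -- imaginary parts.
  set u : n → ℂ := P *ᵥ fun i => if d i = 0 then β i else 0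
  have hAu : A.map Complex.ofReal *ᵥ u = 0 := by
    have h0 : (Matrix.diagonal d *ᵥ fun i => if d i = 0 then β i else 0) = 0 := by
      ext i
      rw [Matrix.mulVec_diagonal]
      split_ifs with h <;> simp [h]
    rw [Matrix.mulVec_mulVec, hA, ← Matrix.mulVec_mulVec, h0, Matrix.mulVec_zero]
  have hCu : C.map Complex.ofReal *ᵥ u = 0 := by
    ext l
    refine Eq.trans ?_ (hsum 0 l)
    rw [Matrix.mulVec_mulVec, Matrix.mulVec, dotProduct, Finset.sum_filter]
    exact Finset.sum_congr rfl fun i _ => by split_ifs <;> simp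
  have hux : u x = 0 := by
    obtain ⟨h1, h2⟩ := mulVec_re_eq_zero hAu
    obtain ⟨h3, h4⟩ := mulVec_re_eq_zero hCu
    exact Complex.ext (hker _ h1 h3) (hker _ h2 h4)
  have hwx : w x = u x := by
    rw [hw, Matrix.mulVec, dotProduct]
    change _ = (P *ᵥ _) x
    rw [Matrix.mulVec, dotProduct]
    refine Finset.sum_congr rfl fun i _ => ?_
    split_ifs with hi
    · rfl
    -- A mode with nonzero eigenvalue is alone in its sum: either it does not reach coordinate `x`,
    -- or `C` sees it and its coefficient is zero.
    · by_cases hPi : P x i = 0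
      · simp [hPi]
      · obtain ⟨l, hl⟩ := hC i hPi
        have h1 := hsum (d i) l
        have hf : (Finset.univ.filter fun j => d j = d i) = {i} := by
          ext j
          simpa using ⟨hd i j hi, fun h => h ▸ rfl⟩
        rw [hf, Finset.sum_singleton] at h1
        rw [(mul_eq_zero.1 h1).resolve_left hl]
  exact Complex.ofReal_eq_zero.1 (hwx.trans hux)

/-! ### Sufficiency: from a rank condition to structural functional observability. -/

/-- A generic real vector with prescribed support is not orthogonal to a complex vector that is
nonzero somewhere on the support. -/
theorem eventually_exists_mul_ne_zero {q n m : Type*} [Fintype n] {C : StructuredMatrix q n}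
    {P : Matrix n m ℂ} {x : n} {i : m} (hC : ∃ k, C k x = true) (hP : P x i ≠ 0) :
    ∀ᶠ c in generic (Stars C), ∃ l, ((realize C c).map Complex.ofReal * P) l i ≠ 0 := by
  classical
  obtain ⟨k, hk⟩ := hC
  -- The real or the imaginary part is nonzero, which reduces the claim to a real polynomial in `c`.
  obtain ⟨φ, hφ⟩ : ∃ φ : ℂ →ₗ[ℝ] ℝ, φ (P x i) ≠ 0 := by
    by_contra! h
    exact hP (Complex.ext (h Complex.reLm) (h Complex.imLm))
  have hp : (fun c => ∑ j, realize C c k j • φ (P j i)) ∈ polyFun (Stars C) :=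
    sum_mem_polyFun fun j _ => mul_mem_polyFun (realize_mem_polyFun C k j) (const_mem_polyFun _)
  have h0 := realize_single_mulVec hk fun j => φ (P j i)
  filter_upwards [eventually_ne_zero hp (h0.trans_ne hφ)] with c hc
  refine ⟨k, fun h => hc ?_⟩
  rw [Matrix.mul_apply] at h
  rw [← map_zero φ, ← h, map_sum]
  refine Finset.sum_congr rfl fun j _ => ?_
  rw [← map_smul, Matrix.map_apply, Complex.real_smul]

/-- If `C` has its support in the columns `X` and the rank of `[A; C]` reaches that of `[A; I_X]`,
then generically the coordinates in `X` vanish on `ker A ∩ ker C`. -/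
theorem eventually_ker_le {n : ℕ} {q : Type*} [Fintype q] {A : StructuredMatrix (Fin n) (Fin n)}
    {C : StructuredMatrix q (Fin n)} {X : Finset (Fin n)} (hCX : ∀ k j, C k j = true → j ∈ X)
    {a₀ : Stars A → ℝ} {c₀ : Stars C → ℝ}
    (h : extendedRank A X ≤ (Matrix.fromRows (realize A a₀) (realize C c₀)).rank) :
    ∀ᶠ a in generic (Stars A), ∀ᶠ c in generic (Stars C), ∀ x ∈ X, ∀ v,
      realize A a *ᵥ v = 0 → realize C c *ᵥ v = 0 → v x = 0 := by
  have hp : ∀ i j, (fun θ : Stars A ⊕ Stars C → ℝ => Matrix.fromRows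
      (realize A fun s => θ (Sum.inl s)) (realize C fun s => θ (Sum.inr s)) i j) ∈
      polyFun (Stars A ⊕ Stars C) := by
    rintro (i | i) j
    · exact comp_mem_polyFun (f := fun θ s => θ (Sum.inl s)) (fun s => coord_mem_polyFun _)
        (realize_mem_polyFun A i j)
    · exact comp_mem_polyFun (f := fun θ s => θ (Sum.inr s)) (fun s => coord_mem_polyFun _)
        (realize_mem_polyFun C i j)
  filter_upwards [eventually_sum (eventually_rank_le hp (Sum.elim a₀ c₀))] with a ha
  filter_upwards [ha] with c hc x hx v hAv hCv
  -- The rank of `[A; C]` is at least that of `[A; I_X]`, while the support of `C` gives `ker [A;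
  -- I_X] ≤ ker [A; C]`; the two kernels therefore coincide.
  have hr : (Matrix.fromRows (realize A a) (idRows X)).rank ≤
      (Matrix.fromRows (realize A a) (realize C c)).rank :=
    (rank_fromRows_idRows_le A X a).trans (h.trans hc)
  have hle (w : Fin n → ℝ) (hw : Matrix.fromRows (realize A a) (idRows X) *ᵥ w = 0) :
      Matrix.fromRows (realize A a) (realize C c) *ᵥ w = 0 := by
    rw [fromRows_mulVec_eq_zero_iff] at hw ⊢
    exact ⟨hw.1, realize_mulVec_eq_zero fun k j hkj =>
      idRows_mulVec_eq_zero_iff.1 hw.2 j (hCX k j hkj)⟩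
  have := ker_le_of_rank_le hle hr v (fromRows_mulVec_eq_zero_iff.2 ⟨hAv, hCv⟩)
  exact idRows_mulVec_eq_zero_iff.1 (fromRows_mulVec_eq_zero_iff.1 this).2 x hx

theorem exists_generic_rank {σ m n : Type*} [Fintype m] [Fintype n]
    {M : (σ → ℝ) → Matrix m n ℝ} (hM : ∀ i j, (fun θ => M θ i j) ∈ polyFun σ) :
    ∃ ρ, ∀ᶠ θ in generic σ, (M θ).rank = ρ := by
  have hb : BddAbove (Set.range fun θ => (M θ).rank) :=
    ⟨Fintype.card n, by rintro _ ⟨θ, rfl⟩; exact Matrix.rank_le_card_width _⟩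
  obtain ⟨θ₀, h₀⟩ := Nat.sSup_mem (Set.range_nonempty _) hb
  refine ⟨(M θ₀).rank, ?_⟩
  filter_upwards [eventually_rank_le hM θ₀] with θ hθ
  exact le_antisymm ((le_csSup hb ⟨θ, rfl⟩).trans_eq h₀.symm) hθ

/-- The observability matrix of `(A, C)`. -/
def observabilityMatrix {n : ℕ} {q : Type*} (A : Matrix (Fin n) (Fin n) ℝ)
    (C : Matrix q (Fin n) ℝ) : Matrix (Fin n × q) (Fin n) ℝ :=
  Matrix.of fun k j => (C * A ^ (k.1 : ℕ)) k.2 j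

/-- By Cayley-Hamilton the powers below `n` suffice. The unobservable subspace becomes the kernel of
one finite matrix with polynomial entries, to which generic rank applies. -/
theorem observabilityMatrix_mulVec_eq_zero_iff {n : ℕ} {q : Type*} {A : Matrix (Fin n) (Fin n) ℝ}
    {C : Matrix q (Fin n) ℝ} {v : Fin n → ℝ} :
    observabilityMatrix A C *ᵥ v = 0 ↔ v ∈ unobservable A C := by
  rw [mem_unobservable]
  constructor
  · intro h k
    -- For `n = 0` the characteristic polynomial is `1` and no remainder has degree below `n`.
    rcases Nat.eq_zero_or_pos n with rfl | hn
    · rw [Subsingleton.elim v 0, Matrix.mulVec_zero]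
    have hlt (i : ℕ) (hi : i < n) : (C * A ^ i) *ᵥ v = 0 :=
      funext fun l => congrFun h (⟨i, hi⟩, l)
    have hdeg : (Polynomial.X ^ k %ₘ A.charpoly).natDegree < n := by
      have := Polynomial.natDegree_modByMonic_lt (Polynomial.X ^ k) A.charpoly_monic
        (fun h1 => by
          have := A.charpoly_natDegree_eq_dim
          rw [h1, Polynomial.natDegree_one, Fintype.card_fin] at this
          omega)
      rwa [A.charpoly_natDegree_eq_dim, Fintype.card_fin] at this
    rw [Matrix.pow_eq_aeval_mod_charpoly, Polynomial.aeval_eq_sum_range' hdeg, Matrix.mul_sum,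
      Matrix.sum_mulVec]
    refine Finset.sum_eq_zero fun i hi => ?_
    rw [Matrix.mul_smul, Matrix.smul_mulVec, hlt i (Finset.mem_range.1 hi), smul_zero]
  · intro h
    exact funext fun k => congrFun (h k.1) k.2

theorem observabilityMatrix_mem_polyFun {n : ℕ} {σ q : Type*}
    {A : (σ → ℝ) → Matrix (Fin n) (Fin n) ℝ} {C : (σ → ℝ) → Matrix q (Fin n) ℝ}
    (hA : ∀ i j, (fun θ => A θ i j) ∈ polyFun σ) (hC : ∀ i j, (fun θ => C θ i j) ∈ polyFun σ)
    (k : Fin n × q) (j : Fin n) :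
    (fun θ => observabilityMatrix (A θ) (C θ) k j) ∈ polyFun σ :=
  mul_apply_mem_polyFun hC (pow_apply_mem_polyFun hA _) _ _

/-- Vanishing of the functional states on the unobservable subspace for a generic `C` after a
generic `A` suffices for structural functional observability. -/
theorem sfo_of_eventually_eq_zero {n r : ℕ} {q : Type*} [Fintype q]
    {A : StructuredMatrix (Fin n) (Fin n)} {C : StructuredMatrix q (Fin n)}
    {F : StructuredMatrix (Fin r) (Fin n)}
    (h : ∀ᶠ a in generic (Stars A), ∀ᶠ c in generic (Stars C),
      ∀ v ∈ unobservable (realize A a) (realize C c), ∀ x ∈ functionalStates F, v x = 0) :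
    SFO A C F := by
  set X := functionalStates F
  let O : (Stars A ⊕ Stars C → ℝ) → Matrix (Fin n × q) (Fin n) ℝ := fun θ => observabilityMatrix
    (realize A fun s => θ (Sum.inl s)) (realize C fun s => θ (Sum.inr s))
  have hO : ∀ i j, (fun θ => O θ i j) ∈ polyFun (Stars A ⊕ Stars C) :=
    observabilityMatrix_mem_polyFun
      (fun i j => comp_mem_polyFun (f := fun θ s => θ (Sum.inl s)) (fun s => coord_mem_polyFun _)
        (realize_mem_polyFun A i j))
      (fun i j => comp_mem_polyFun (f := fun θ s => θ (Sum.inr s)) (fun s => coord_mem_polyFun _)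
        (realize_mem_polyFun C i j))
  have hO' : ∀ i j, (fun θ => Matrix.fromRows (O θ) (idRows X) i j) ∈
      polyFun (Stars A ⊕ Stars C) := by
    rintro (i | i) j
    · exact hO i j
    · exact const_mem_polyFun _
  obtain ⟨ρ, hρ⟩ := exists_generic_rank hO
  obtain ⟨ρ', hρ'⟩ := exists_generic_rank hO'
  -- Both ranks are constant for jointly generic parameters, so one pair `(a, c)` satisfying every
  -- condition compares them. This supplies the joint genericity that iterated genericity alone does
  -- not give.
  have hle : ρ' ≤ ρ := by
    obtain ⟨a, ha, ha'⟩ := (h.and (eventually_sum (hρ.and hρ'))).exists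
    obtain ⟨c, hc, h1, h2⟩ := (ha.and ha').exists
    rw [← h1, ← h2]
    refine rank_le_of_ker_le fun v hv => fromRows_mulVec_eq_zero_iff.2 ⟨hv, ?_⟩
    exact idRows_mulVec_eq_zero_iff.2 (hc v (observabilityMatrix_mulVec_eq_zero_iff.1 hv))
  have hgen : ∀ᶠ θ in generic (Stars A ⊕ Stars C), ∀ v ∈ unobservable
      (realize A fun s => θ (Sum.inl s)) (realize C fun s => θ (Sum.inr s)),
      ∀ x ∈ X, v x = 0 := by
    filter_upwards [hρ, hρ'] with θ h1 h2 v hv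
    have := ker_le_of_rank_le (M := O θ) (N := Matrix.fromRows (O θ) (idRows X))
      (fun w hw => (fromRows_mulVec_eq_zero_iff.1 hw).1) (by omega) v
      (observabilityMatrix_mulVec_eq_zero_iff.2 hv)
    exact idRows_mulVec_eq_zero_iff.1 (fromRows_mulVec_eq_zero_iff.1 this).2
  have hinj : Function.Injective
      (Sum.map id Sum.inl : Stars A ⊕ Stars C → Stars A ⊕ Stars C ⊕ Stars F) :=
    Function.injective_id.sumMap Sum.inl_injective
  rw [sfo_iff]
  filter_upwards [eventually_comp hinj hgen] with θ hθ
  exact functionallyObservable_iff.2 fun v hv => realize_mulVec_eq_zero fun k j hkj =>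
    hθ v hv j (mem_functionalStates.2 ⟨k, hkj⟩)

/-- A sufficient condition for structural functional observability. -/
theorem sfo_of_extendedRank_le {n r : ℕ} {q : Type*} [Fintype q]
    {A : StructuredMatrix (Fin n) (Fin n)} {C : StructuredMatrix q (Fin n)}
    {F : StructuredMatrix (Fin r) (Fin n)} (hA : GenericallyDiagonalizable A)
    (hCX : ∀ j, j ∈ functionalStates F ↔ ∃ k, C k j = true)
    {a₀ : Stars A → ℝ} {c₀ : Stars C → ℝ} (h : extendedRank A (functionalStates F) ≤
      (Matrix.fromRows (realize A a₀) (realize C c₀)).rank) : SFO A C F := by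
  refine sfo_of_eventually_eq_zero ?_
  filter_upwards [hA.eventually, eventually_not_sq_dvd_charpoly A,
    eventually_ker_le (fun k j hkj => (hCX j).2 ⟨k, hkj⟩) h] with a hdiag hsimple hker
  obtain ⟨P, d, hP, hAP, hchar⟩ := hdiag.exists_mul_eq
  rw [hchar] at hsimple
  -- The eigenvector matrix `P` is not controlled polynomially by `a`; the parameters of `C` are
  -- therefore taken generic after `a` is fixed.
  have hC : ∀ᶠ c in generic (Stars C), ∀ x i, x ∈ functionalStates F → P x i ≠ 0 →
      ∃ l, ((realize C c).map Complex.ofReal * P) l i ≠ 0 := by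
    simp only [Filter.eventually_all]
    exact fun x i hx hPi => eventually_exists_mul_ne_zero ((hCX x).1 hx) hPi
  filter_upwards [hker, hC] with c hkerc hCc v hv x hx
  exact eq_zero_of_mem_unobservable hP hAP (fun i j hi hij => eq_of_not_sq_dvd hsimple hi hij)
    (hkerc x hx) (fun i hPi => hCc x i hx hPi) hv

/-! ### Optimality of the algorithm. -/

theorem unmatchedFunctional_eq {n r : ℕ} (F : StructuredMatrix (Fin r) (Fin n))
    (M : Finset (Fin n × Fin n)) :
    unmatchedFunctional F M = functionalStates F \ rightMatched M := by
  simp [unmatchedFunctional, matchedFunctional]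

namespace SensorAlgorithmRun

variable {n r : ℕ} {A : StructuredMatrix (Fin n) (Fin n)} {F : StructuredMatrix (Fin r) (Fin n)}

theorem output_eq_true_iff (R : SensorAlgorithmRun A F) {k i} : R.output k i = true ↔
    (∃ t : Fin (unmatchedFunctional F R.M).card, (t : ℕ) = (k : ℕ) ∧ (R.enum t : Fin n) = i) ∨
      ∃ s : {i // i ∈ matchedFunctional F R.M}, s.1 = i ∧ R.row s = k := by
  simp only [output, Matrix.of_apply, decide_eq_true_eq]

theorem mem_functionalStates_iff (R : SensorAlgorithmRun A F) (i : Fin n) :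
    i ∈ functionalStates F ↔ ∃ k, R.output k i = true := by
  simp only [output_eq_true_iff]
  constructor
  · intro hi
    by_cases hm : i ∈ matchedFunctional F R.M
    · exact ⟨R.row ⟨i, hm⟩, Or.inr ⟨⟨i, hm⟩, rfl, rfl⟩⟩
    · have hu : i ∈ unmatchedFunctional F R.M := Finset.mem_sdiff.2 ⟨hi, hm⟩
      exact ⟨Fin.castLE (le_max_right _ _) (R.enum.symm ⟨i, hu⟩),
        Or.inl ⟨R.enum.symm ⟨i, hu⟩, rfl, by simp⟩⟩
  · rintro ⟨k, ⟨t, -, rfl⟩ | ⟨s, rfl, -⟩⟩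
    · exact (Finset.mem_sdiff.1 (R.enum t).2).1
    · exact (Finset.mem_inter.1 s.2).1

theorem card_unmatchedFunctional (R : SensorAlgorithmRun A F) :
    (unmatchedFunctional F R.M).card = extendedRank A (functionalStates F) - grank A := by
  rw [unmatchedFunctional_eq, ← R.isMinWeight.card_sdiff, Nat.add_sub_cancel_left]

/-- The rank condition is tested with ones on the matching and on the stars of `X_F^u`, and zeros on
the other stars. The stars of `X_S` are needed only to see the modes with nonzero eigenvalue. -/
theorem sfo_output (R : SensorAlgorithmRun A F) (hA : GenericallyDiagonalizable A) :
    SFO A R.output F := by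
  classical
  let B : Matrix (Fin (max 1 (unmatchedFunctional F R.M).card)) (Fin n) ℝ :=
    Matrix.of fun k i => if ∃ t : Fin (unmatchedFunctional F R.M).card,
      (t : ℕ) = (k : ℕ) ∧ (R.enum t : Fin n) = i then 1 else 0
  have hB : realize R.output (fun s => B s.1.1 s.1.2) = B := by
    refine realize_eq fun k i hki => if_neg fun ht => ?_
    rw [R.output_eq_true_iff.2 (Or.inl ht)] at hki
    exact Bool.noConfusion hki
  refine sfo_of_extendedRank_le hA R.mem_functionalStates_iff
    (a₀ := matchingParameters A R.M) (c₀ := fun s => B s.1.1 s.1.2) ?_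
  rw [hB, ← R.isMinWeight.card_sdiff, ← R.isMinWeight.1.card_eq]
  refine R.isMinWeight.1.1.card_add_card_le_rank Finset.sdiff_disjoint fun u hu => ?_
  rw [← unmatchedFunctional_eq] at hu
  refine ⟨Fin.castLE (le_max_right _ _) (R.enum.symm ⟨u, hu⟩), fun j => if_congr ?_ rfl rfl⟩
  constructor
  · rintro ⟨t, ht, rfl⟩
    rw [Fin.val_castLE] at ht
    rw [Fin.ext ht, Equiv.apply_symm_apply]
  · rintro rfl
    exact ⟨R.enum.symm ⟨u, hu⟩, rfl, by simp⟩

theorem nonempty (A : StructuredMatrix (Fin n) (Fin n)) (F : StructuredMatrix (Fin r) (Fin n)) :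
    Nonempty (SensorAlgorithmRun A F) := by
  obtain ⟨M, hM⟩ := exists_isMinWeightMaximumMatching A (functionalStates F)
  -- The `max 1` guarantees a row `0`, which can receive every element of `X_S`.
  exact ⟨⟨M, hM, (unmatchedFunctional F M).equivFin.symm, fun _ => ⟨0, by simp⟩⟩⟩

theorem isLeast (R : SensorAlgorithmRun A F) (hA : GenericallyDiagonalizable A) :
    IsLeast {p | 1 ≤ p ∧ SensorsSuffice A F p} (max 1 (unmatchedFunctional F R.M).card) := by
  refine ⟨⟨le_max_left _ _, R.output, R.sfo_output hA⟩, ?_⟩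
  rintro p ⟨hp, C, hC⟩
  have h1 := hC.extendedRank_le
  have h2 := R.card_unmatchedFunctional
  omega

end SensorAlgorithmRun

end StructuredSystem

open StructuredSystem
theorem mainTheorem5 {n r : ℕ} (A : StructuredMatrix (Fin n) (Fin n))
    (F : StructuredMatrix (Fin r) (Fin n)) (hA : GenericallyDiagonalizable A) :
    -- the closed form is the minimum number of sensors
    IsLeast {p | 1 ≤ p ∧ SensorsSuffice A F p}
      (max (grank (Matrix.fromRows A (structuredId (functionalStates F))) - grank A) 1) ∧
    -- the restriction to at least one sensor is automatic when there is a functional state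
    ((functionalStates F).Nonempty → ¬ SensorsSuffice A F 0) ∧
    -- the expression through maximum matchings
    (∃ Xu, IsLargestRightUnmatchedSubset A (functionalStates F) Xu) ∧
    (∀ Xu, IsLargestRightUnmatchedSubset A (functionalStates F) Xu →
      IsLeast {p | 1 ≤ p ∧ SensorsSuffice A F p} (max Xu.card 1)) ∧
    -- the algorithm can be carried out, and whatever its choices, its output is optimal
    Nonempty (SensorAlgorithmRun A F) ∧
    (∀ R : SensorAlgorithmRun A F, IsOptimalPlacement A F R.output) := by
  have hR := SensorAlgorithmRun.nonempty A F
  have hmin : IsLeast {p | 1 ≤ p ∧ SensorsSuffice A F p}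
      (max (extendedRank A (functionalStates F) - grank A) 1) := by
    obtain ⟨R⟩ := hR
    rw [← R.card_unmatchedFunctional, max_comm]
    exact R.isLeast hA
  exact ⟨hmin, not_sensorsSuffice_zero, exists_isLargestRightUnmatchedSubset A _,
    fun Xu hXu => by rwa [hXu.card_eq], hR, fun R => ⟨R.sfo_output hA, R.isLeast hA⟩⟩
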